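/- Let $A_1,\dots,A_d:\mathbb R^d\times\mathbb R^d\to\mathbb R$ be smooth functions of $(p,x)$ that are pairwise in involution, $\{A_j,A_k\}=0$ for all $j,k$, where $\{f,g\}=\sum_{i}\big(\frac{\partial f}{\partial p_i}\frac{\partial g}{\partial x_i}-\frac{\partial f}{\partial x_i}\frac{\partial g}{\partial p_i}\big)$, and suppose that their Hamiltonian flows $\phi_1^t,\dots,\phi_d^t$ ($\dot p=-\partial_xA_j$, $\dot x=\partial_pA_j$) are defined on $\mathbb R^d\times\mathbb R^d$ for all $t\in\mathbb R$. Let $G$ be a subgroup of $\mathrm U(n)$ with Lie algebra $\mathfrak g$ (the velocities at the identity of smooth curves in $G$), and let $$Y_j^t:\ \mathbb R^d\times\mathbb R^d\times G\to\mathbb R^d\times\mathbb R^d\times G,\qquad (z,g)\mapsto(\phi_j^t(z),\,D_j(z,t)\,g),\qquad j=1,\dots,d,$$ be $G$-extensions of all these flows with smooth generators $M_j:\mathbb R^d\times\mathbb R^d\to\mathfrak g$, that is, $D_j$ takes values in $G$ and $$\dot D_j(z,t)+M_j(\phi_j^t(z))\,D_j(z,t)=0,\qquad D_j(z,0)=1.$$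 Assume that $\{A_j,M_k\}+\{M_j,A_k\}+[M_j,M_k]=0$ for all $j,k=1,\dots,d$. Then the $G$-extensions commute: $Y_j^s\circ Y_k^t=Y_k^t\circ Y_j^s$ for all $j,k,s,t$. Moreover, let $T=\{z: A_j(z)=a_j,\ j=1,\dots,d\}$ be a Liouville–Arnold torus, i.e. $T$ is compact and connected (and non-empty) and $dA_1,\dots,dA_d$ are linearly independent at each point of $T$. Put $\Phi^{t}=\phi_d^{t_d}\circ\cdots\circ\phi_1^{t_1}$ for $t\in\mathbb R^d$, and let $D(z,t)\in G$ be the multi-time cocycle, $(Y_d^{t_d}\circ\cdots\circ Y_1^{t_1})(z,g)=(\Phi^{t}(z),D(z,t)g)$. Then the following hold. 1. The transport equations define a connection on the trivial principal bundle $T\times G$: there is exactly one smooth $\mathfrak g$-valued one-form $\eta$ on $T$ whose value on the Hamiltonian vector field $X_{A_j}$ is $M_j$ for every $j$. A curve $(c,g)$ in $T\times G$ is horizontal if $\dot g+\eta(\dot c)\,g=0$, and the holonomy group $H_z$ at $z\in T$ is the group of all $h\in G$ such that $(z,1)$ and $(z,h)$ are joined by a piecewise $C^1$ horizontal curve. 2.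 $H_z$ is an Abelian subgroup of $G$ for every $z\in T$. 3. There are $\tau_1,\dots,\tau_d\in\mathbb R^d$ and a homeomorphism $e:(\mathbb R/2\pi\mathbb Z)^d\to T$ (angular coordinates $\vartheta$) such that $\Phi^{\sum_j (s_j/2\pi)\tau_j}(e(\vartheta))=e(\vartheta+s)$ for all $\vartheta$ and all $s\in\mathbb R^d$; so along $\Phi^{r\tau_j}$, $0\le r\le1$, the angle $\vartheta_j$ increases by $2\pi$ and the other angles are constant. For every such choice and every $z\in T$, the loop cocycles $d_j(z):=D(z,\tau_j)$ satisfy $(Y_d^{(\tau_j)_d}\circ\cdots\circ Y_1^{(\tau_j)_1})(z,g)=(z,d_j(z)\,g)$ for all $g\in G$, they commute with each other, and they generate $H_z$. 4. For any $z,z'\in T$ there is $t\in\mathbb R^d$ with $\Phi^t(z)=z'$, and for every such $t$ one has $H_{z'}=D(z,t)\,H_z\,D(z,t)^{-1}$. -/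

import Mathlib

open scoped ContDiff Matrix.Norms.Operator

namespace SkewProduct

/-- The phase space `ℝ^d × ℝ^d`; points are pairs `(p, x)` of momentum and position. -/
abbrev Phase (d : ℕ) : Type := (Fin d → ℝ) × (Fin d → ℝ)

/-- Complex `n × n` matrices. -/
abbrev Mat (n : ℕ) : Type := Matrix (Fin n) (Fin n) ℂ

section Hamiltonian

variable {d : ℕ} {F : Type*} [NormedAddCommGroup F] [NormedSpace ℝ F]

/-- `∂f/∂p_i`. -/
noncomputable def dP (f : Phase d → F) (i : Fin d) (z : Phase d) : F :=
  fderiv ℝ f z (Pi.single i 1, 0)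

/-- `∂f/∂x_i`. -/
noncomputable def dX (f : Phase d → F) (i : Fin d) (z : Phase d) : F :=
  fderiv ℝ f z (0, Pi.single i 1)

/-- The Hamiltonian vector field of `H`: `p' = -∂H/∂x`, `x' = ∂H/∂p`. -/
noncomputable def hamVec (H : Phase d → ℝ) (z : Phase d) : Phase d :=
  (fun i => -dX H i z, fun i => dP H i z)

/-- The Poisson bracket `{f, g} = ∑ i, (∂f/∂p_i ∂g/∂x_i - ∂f/∂x_i ∂g/∂p_i)` of a real function `f`
with a real or vector valued function `g`; it is the derivative of `g` along the Hamiltonian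
flow of `f`. -/
noncomputable def bracket (f : Phase d → ℝ) (g : Phase d → F) (z : Phase d) : F :=
  ∑ i, (dP f i z • dX g i z - dX f i z • dP g i z)

/-- The Poisson bracket `{g, f} = ∑ i, (∂g/∂p_i ∂f/∂x_i - ∂g/∂x_i ∂f/∂p_i)` with the vector valued
function in the first slot. -/
noncomputable def bracketLeft (g : Phase d → F) (f : Phase d → ℝ) (z : Phase d) : F :=
  ∑ i, (dX f i z • dP g i z - dP f i z • dX g i z)

/-- `φ` is the (complete) Hamiltonian flow of `H`. -/
structure IsHamiltonianFlow (H : Phase d → ℝ) (φ : ℝ → Phase d → Phase d) : Prop where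
  zero : ∀ z, φ 0 z = z
  ode : ∀ z t, HasDerivAt (fun s => φ s z) (hamVec H (φ t z)) t

/-- The functions `A_1, …, A_d` are pairwise in involution. -/
def InInvolution (A : Fin d → Phase d → ℝ) : Prop :=
  ∀ j k z, bracket (A j) (A k) z = 0

/-- The joint level set `M_a = {z | A_j z = a_j for all j}`. -/
def levelSet (A : Fin d → Phase d → ℝ) (a : Fin d → ℝ) : Set (Phase d) :=
  {z | ∀ j, A j z = a j}

/-- `M_a` is a Liouville–Arnold torus: it is compact and connected (in particular non-empty), and
the differentials `dA_1, …, dA_d` are linearly independent at each of its points. -/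
structure IsLiouvilleArnoldTorus (A : Fin d → Phase d → ℝ) (a : Fin d → ℝ) : Prop where
  compact : IsCompact (levelSet A a)
  connected : IsConnected (levelSet A a)
  independent : ∀ z ∈ levelSet A a, LinearIndependent ℝ (fun j => fderiv ℝ (A j) z)

/-- The common kernel of the differentials `dA_j`: at a point `z` of a regular joint level set this
is the tangent space of the level set. -/
noncomputable def tangentAt (A : Fin d → Phase d → ℝ) (z : Phase d) : Submodule ℝ (Phase d) :=
  ⨅ j, LinearMap.ker (fderiv ℝ (A j) z : Phase d →ₗ[ℝ] ℝ)

theorem fderiv_hamVec (f : Phase d → ℝ) (g : Phase d → F) (z : Phase d) :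
    fderiv ℝ g z (hamVec f z) = bracket f g z := by
  have h : hamVec f z = ∑ i, (dP f i z • ((0, Pi.single i 1) : Phase d)
      - dX f i z • ((Pi.single i 1, 0) : Phase d)) := by
    ext k <;>
      simp [hamVec, Finset.sum_apply, Prod.fst_sum, Prod.snd_sum, Pi.single_apply]
  rw [h, map_sum]
  simp only [map_sub, map_smul]
  rfl

theorem hamVec_mem_tangentAt {A : Fin d → Phase d → ℝ} (hA : InInvolution A) (j : Fin d)
    (z : Phase d) : hamVec (A j) z ∈ tangentAt A z := by
  simp only [tangentAt, Submodule.mem_iInf, LinearMap.mem_ker]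
  intro k
  exact (fderiv_hamVec (A j) (A k) z).trans (hA j k z)

end Hamiltonian

/-- The multi-time map `F_d^{t_d} ∘ ⋯ ∘ F_1^{t_1}` of a family `F_1, …, F_d` of flows. -/
def multiTime {d : ℕ} {α : Type*} (F : Fin d → ℝ → α → α) (t : Fin d → ℝ) (y : α) : α :=
  Fin.foldl d (fun w j => F j (t j) w) y

section Group

variable {d n : ℕ}

/-- The matrix of an element of a subgroup of `U(n)`. -/
def toMat {G : Subgroup (Matrix.unitaryGroup (Fin n) ℂ)} (g : G) : Mat n := g.1.1

@[simp] theorem toMat_one {G : Subgroup (Matrix.unitaryGroup (Fin n) ℂ)} :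
    toMat (1 : G) = 1 := rfl

@[simp] theorem toMat_mul {G : Subgroup (Matrix.unitaryGroup (Fin n) ℂ)} (g h : G) :
    toMat (g * h) = toMat g * toMat h := rfl

/-- The Lie algebra of a subgroup `G` of `U(n)`: the velocities at the identity of the smooth
curves in `G`. -/
def lieAlg (G : Subgroup (Matrix.unitaryGroup (Fin n) ℂ)) : Submodule ℝ (Mat n) where
  carrier := {X | ∃ c : ℝ → G, ContDiff ℝ ∞ (fun t => toMat (c t)) ∧ c 0 = 1 ∧
    HasDerivAt (fun t => toMat (c t)) X 0}
  add_mem' := by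
    rintro X Y ⟨b, hb, hb0, hb'⟩ ⟨c, hc, hc0, hc'⟩
    refine ⟨fun t => b t * c t, ?_, by simp [hb0, hc0], ?_⟩
    · simpa using hb.mul hc
    · have h := hb'.mul hc'
      simp only [hb0, hc0, toMat_one, mul_one, one_mul] at h
      exact h
  zero_mem' := ⟨fun _ => 1, contDiff_const, rfl, hasDerivAt_const _ _⟩
  smul_mem' := by
    rintro r X ⟨c, hc, hc0, hc'⟩
    refine ⟨fun t => c (r * t), ?_, by simp [hc0], ?_⟩
    · exact hc.comp (contDiff_const.mul contDiff_id)
    · have h1 : HasDerivAt (fun t : ℝ => r * t) r 0 := by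
        simpa using (hasDerivAt_id (0 : ℝ)).const_mul r
      have h2 : HasDerivAt (fun t => toMat (c t)) X (r * 0) := by simpa using hc'
      exact h2.scomp (0 : ℝ) h1

variable {G : Subgroup (Matrix.unitaryGroup (Fin n) ℂ)}

/-- `D` is the `G`-valued solution of the transport equation with generator `M` along `φ`:
`d/dt D(z,t) + M(φ^t z) D(z,t) = 0` and `D(z,0) = 1`. -/
structure IsTransport (φ : ℝ → Phase d → Phase d) (M : Phase d → lieAlg G)
    (D : Phase d → ℝ → G) : Prop where
  zero : ∀ z, D z 0 = 1
  ode : ∀ z t, HasDerivAt (fun s => toMat (D z s)) (-((M (φ t z) : Mat n) * toMat (D z t))) t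

/-- The `G`-extension `Y^t (z, g) = (φ^t z, D(z,t) g)`. -/
def extension (φ : ℝ → Phase d → Phase d) (D : Phase d → ℝ → G) (t : ℝ)
    (y : Phase d × G) : Phase d × G :=
  (φ t y.1, D y.1 t * y.2)

/-- The multi-time cocycle `D(z, t)`: the group component of `(Y_d^{t_d} ∘ ⋯ ∘ Y_1^{t_1})(z, 1)`. -/
def multiCocycle (φ : Fin d → ℝ → Phase d → Phase d) (D : Fin d → Phase d → ℝ → G)
    (z : Phase d) (t : Fin d → ℝ) : G :=
  (multiTime (fun j => extension (φ j) (D j)) t (z, 1)).2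

/-- A connection in the trivial principal bundle `M_a × G` (on which `G` acts by right
multiplication), given by its connection form in the global trivialisation: a smooth one-form on the
submanifold `M_a` with values in the Lie algebra of `G`. Smooth means, as usual on a submanifold,
that the form has local extensions to smooth one-forms of the ambient space. -/
@[ext] structure Connection (A : Fin d → Phase d → ℝ) (a : Fin d → ℝ)
    (G : Subgroup (Matrix.unitaryGroup (Fin n) ℂ)) where
  form : (z : levelSet A a) → tangentAt A z →ₗ[ℝ] lieAlg G
  smooth : ∀ z : levelSet A a, ∃ (U : Set (Phase d)) (Ω : Phase d → Phase d →ₗ[ℝ] Mat n),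
    IsOpen U ∧ (z : Phase d) ∈ U ∧ (∀ v, ContDiffOn ℝ ∞ (fun w => Ω w v) U) ∧
    ∀ w : levelSet A a, (w : Phase d) ∈ U → ∀ v : tangentAt A w, Ω w v = (form w v : Mat n)

variable {A : Fin d → Phase d → ℝ} {a : Fin d → ℝ}

/-- `y` and `y'` are the end points of a continuously differentiable horizontal curve
`t ↦ (c t, g t)`, `0 ≤ t ≤ 1`, in `M_a × G`: the velocity `v` of `c` is continuous and
`g' + η(v) g = 0`. -/
def HorizontalStep (η : Connection A a G) (y y' : levelSet A a × G) : Prop :=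
  ∃ (c : ℝ → levelSet A a) (v : (t : ℝ) → tangentAt A (c t)) (g : ℝ → G),
    (∀ t ∈ Set.Icc (0 : ℝ) 1,
      HasDerivWithinAt (fun s => (c s : Phase d)) (v t : Phase d) (Set.Icc 0 1) t) ∧
    ContinuousOn (fun t => (v t : Phase d)) (Set.Icc 0 1) ∧
    (∀ t ∈ Set.Icc (0 : ℝ) 1,
      HasDerivWithinAt (fun s => toMat (g s)) (-((η.form (c t) (v t) : Mat n) * toMat (g t)))
        (Set.Icc 0 1) t) ∧
    (c 0, g 0) = y ∧ (c 1, g 1) = y'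

/-- `y` and `y'` can be joined by a horizontal curve that is piecewise continuously
differentiable. -/
def HorizontallyJoined (η : Connection A a G) : levelSet A a × G → levelSet A a × G → Prop :=
  Relation.ReflTransGen (HorizontalStep η)

theorem HorizontalStep.symm {η : Connection A a G} {y y' : levelSet A a × G}
    (h : HorizontalStep η y y') : HorizontalStep η y' y := by
  obtain ⟨c, v, g, hc, hv, hg, h0, h1⟩ := h
  have hr : ∀ t : ℝ, HasDerivWithinAt (fun s : ℝ => 1 - s) (-1) (Set.Icc 0 1) t := fun t => by
    simpa using ((hasDerivAt_id t).const_sub 1).hasDerivWithinAt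
  have hm : Set.MapsTo (fun s : ℝ => 1 - s) (Set.Icc 0 1) (Set.Icc 0 1) := by
    intro s hs
    exact ⟨by linarith [hs.2], by linarith [hs.1]⟩
  refine ⟨fun t => c (1 - t), fun t => -v (1 - t), fun t => g (1 - t), ?_, ?_, ?_, ?_, ?_⟩
  · intro t ht
    have := (hc (1 - t) (hm ht)).scomp t (hr t) hm
    simpa [Function.comp_def] using this
  · exact (hv.comp (continuous_const.sub continuous_id).continuousOn hm).neg
  · intro t ht
    have h2 := (hg (1 - t) (hm ht)).scomp t (hr t) hm
    have h3 : (-1 : ℝ) • (-((η.form (c (1 - t)) (v (1 - t)) : Mat n) * toMat (g (1 - t)))) =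
        -((η.form (c (1 - t)) (-v (1 - t)) : Mat n) * toMat (g (1 - t))) := by simp
    rw [← h3]
    exact h2
  · simpa using h1
  · simpa using h0

theorem HorizontalStep.mul_right {η : Connection A a G} {y y' : levelSet A a × G}
    (h : HorizontalStep η y y') (k : G) :
    HorizontalStep η (y.1, y.2 * k) (y'.1, y'.2 * k) := by
  obtain ⟨c, v, g, hc, hv, hg, rfl, rfl⟩ := h
  refine ⟨c, v, fun t => g t * k, hc, hv, ?_, rfl, rfl⟩
  intro t ht
  have h2 := (hg t ht).mul_const (toMat k)
  rw [neg_mul, mul_assoc] at h2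
  exact h2

theorem HorizontallyJoined.symm {η : Connection A a G} {y y' : levelSet A a × G}
    (h : HorizontallyJoined η y y') : HorizontallyJoined η y' y := by
  induction h with
  | refl => exact Relation.ReflTransGen.refl
  | tail _ h2 ih => exact Relation.ReflTransGen.head h2.symm ih

theorem HorizontallyJoined.mul_right {η : Connection A a G} {y y' : levelSet A a × G}
    (h : HorizontallyJoined η y y') (k : G) :
    HorizontallyJoined η (y.1, y.2 * k) (y'.1, y'.2 * k) := by
  induction h with
  | refl => exact Relation.ReflTransGen.refl
  | tail _ h2 ih => exact Relation.ReflTransGen.tail ih (h2.mul_right k)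

/-- The holonomy group of a connection with reference point `(z, 1)`: the elements `h` of `G` such
that `(z, 1)` and `(z, 1) h = (z, h)` can be joined by a piecewise continuously differentiable
horizontal curve. -/
def holonomyGroup (η : Connection A a G) (z : levelSet A a) : Subgroup G where
  carrier := {h | HorizontallyJoined η (z, 1) (z, h)}
  one_mem' := Relation.ReflTransGen.refl
  mul_mem' := by
    intro g h hg hh
    have := HorizontallyJoined.mul_right hg h
    simp only [one_mul] at this
    exact Relation.ReflTransGen.trans hh this
  inv_mem' := by
    intro g hg
    have := HorizontallyJoined.mul_right (HorizontallyJoined.symm hg) g⁻¹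
    simpa using this

/-- Angular coordinates `e` on `M_a` in which all flows are linear, together with the basis
`τ_1, …, τ_d` of multi-times: along the flow `Φ^{s τ_j}`, `0 ≤ s ≤ 1`, the angle `ϑ_j` increases by
`2π` and all the other angles remain constant, so that this flow runs through the `j`-th basis
cycle of the torus. -/
def IsAngularChart (φ : Fin d → ℝ → Phase d → Phase d) (A : Fin d → Phase d → ℝ) (a : Fin d → ℝ)
    (τ : Fin d → Fin d → ℝ) (e : (Fin d → Real.Angle) ≃ₜ levelSet A a) : Prop :=
  ∀ (θ : Fin d → Real.Angle) (s : Fin d → ℝ),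
    multiTime φ (∑ j, (s j / (2 * Real.pi)) • τ j) (e θ : Phase d) =
      (e (fun j => θ j + (s j : Real.Angle)) : Phase d)

end Group

end SkewProduct

open SkewProduct

/-!
The extension of the Hamiltonian flow of `A_j` is the flow, on `ℝ^d × ℝ^d × Mat n`, of the vector
field `V_j (z, g) = (X_j z, -M_j(z) g)`, where `X_j` is the Hamiltonian vector field of `A_j`. Since
the `A_j` are in involution the `X_j` commute, and the bracket condition on the `M_j` says exactly
that then the `V_j` commute as well. Complete flows of commuting vector fields commute
(`IsFlow.comm`); this is derived from Grönwall's inequality and continuous dependence on the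
initial point, without differentiability of the flow in the initial point. So the extended flows
form an action of `ℝ^d`, which is differentiable in time (`hasStrictFDerivAt_multiTime`).

On a Liouville–Arnold torus `T` the `X_j` form a basis of each tangent space. Hence there is exactly
one one-form `η` with `η(X_j) = M_j`, and the orbits of the action on `T` are open. As `T` is
connected and compact there is one orbit only, and its stabiliser, the group of periods, is a
lattice in `ℝ^d`; a basis of this lattice yields the angular coordinates
(`exists_isAngularChart`). Conversely, the multi-times `τ_j` of any angular chart generate the
periods (`exists_eq_sum_zsmul_period`).

A horizontal curve over `T` has velocity `∑ u_j V_j` with continuous coefficients `u_j`. By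
uniqueness of solutions it therefore ends where the action of the multi-time `∫ u` takes its starting point,
and horizontally joined points are precisely the points in the same orbit of the extended action
(`horizontallyJoined_iff`). So the holonomy group at `z` is the image of the periods under the
cocycle `D(z, ·)`. On the periods the cocycle is a homomorphism of an Abelian group, which gives
commutativity, the generators `D(z, τ_j)` and, by the cocycle identity, the conjugation formula.
-/

namespace SkewProduct

open Set Filter Topology Metric

/-! ### Complete flows of vector fields -/

section Flow

variable {E : Type*} [NormedAddCommGroup E] [NormedSpace ℝ E]

/-- `F` is the (complete) flow of the vector field `V`; the first argument is time. -/
structure IsFlow (V : E → E) (F : ℝ → E → E) : Prop where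
  zero : ∀ y, F 0 y = y
  ode : ∀ y t, HasDerivAt (fun s => F s y) (V (F t y)) t

theorem exists_lipschitzOnWith_closedBall [ProperSpace E] {E' : Type*} [NormedAddCommGroup E']
    [NormedSpace ℝ E'] {V : E → E'} (hV : ContDiff ℝ 1 V) (R : ℝ) :
    ∃ K, LipschitzOnWith K V (closedBall 0 R) := by
  obtain ⟨C, hC⟩ := (isCompact_closedBall (0 : E) R).exists_bound_of_continuousOn
    (hV.continuous_fderiv one_ne_zero).continuousOn
  refine ⟨C.toNNReal, (convex_closedBall 0 R).lipschitzOnWith_of_nnnorm_fderiv_le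
    (fun x _ => (hV.differentiable one_ne_zero).differentiableAt) fun x hx => ?_⟩
  exact NNReal.le_toNNReal_of_coe_le (hC x hx)

/-- Uniqueness of integral curves on a compact interval. -/
theorem eqOn_Icc_of_hasDerivWithinAt [ProperSpace E] {V : E → E} (hV : ContDiff ℝ 1 V)
    {a b t₀ : ℝ} (ht₀ : t₀ ∈ Ioo a b) {f g : ℝ → E}
    (hf : ∀ t ∈ Icc a b, HasDerivWithinAt f (V (f t)) (Icc a b) t)
    (hg : ∀ t ∈ Icc a b, HasDerivWithinAt g (V (g t)) (Icc a b) t) (h : f t₀ = g t₀) :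
    EqOn f g (Icc a b) := by
  have hfc : ContinuousOn f (Icc a b) := fun t ht => (hf t ht).continuousWithinAt
  have hgc : ContinuousOn g (Icc a b) := fun t ht => (hg t ht).continuousWithinAt
  obtain ⟨R, hR⟩ := ((isCompact_Icc.image_of_continuousOn hfc).union
    (isCompact_Icc.image_of_continuousOn hgc)).isBounded.subset_closedBall 0
  obtain ⟨K, hK⟩ := exists_lipschitzOnWith_closedBall hV R
  refine ODE_solution_unique_of_mem_Icc (v := fun _ => V) (s := fun _ => closedBall 0 R)
    (fun _ _ => hK) ht₀ hfc (fun t ht => (hf t (Ioo_subset_Icc_self ht)).hasDerivAt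
      (Icc_mem_nhds ht.1 ht.2)) ?_ hgc (fun t ht => (hg t (Ioo_subset_Icc_self ht)).hasDerivAt
      (Icc_mem_nhds ht.1 ht.2)) ?_ h
  · exact fun t ht => hR (Or.inl (mem_image_of_mem f (Ioo_subset_Icc_self ht)))
  · exact fun t ht => hR (Or.inr (mem_image_of_mem g (Ioo_subset_Icc_self ht)))

theorem eq_of_hasDerivAt [ProperSpace E] {V : E → E} (hV : ContDiff ℝ 1 V) {t₀ : ℝ}
    {f g : ℝ → E} (hf : ∀ t, HasDerivAt f (V (f t)) t) (hg : ∀ t, HasDerivAt g (V (g t)) t)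
    (h : f t₀ = g t₀) (t : ℝ) : f t = g t := by
  refine eqOn_Icc_of_hasDerivWithinAt hV (a := min t t₀ - 1) (b := max t t₀ + 1) (t₀ := t₀)
    ⟨?_, ?_⟩ (fun s _ => (hf s).hasDerivWithinAt) (fun s _ => (hg s).hasDerivWithinAt) h ⟨?_, ?_⟩
  · linarith [min_le_right t t₀]
  · linarith [le_max_right t t₀]
  · linarith [min_le_left t t₀]
  · linarith [le_max_left t t₀]

namespace IsFlow

variable {V : E → E} {F : ℝ → E → E}

theorem continuous_time (hF : IsFlow V F) (y : E) : Continuous fun t => F t y :=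
  continuous_iff_continuousAt.2 fun t => (hF.ode y t).continuousAt

theorem eq_of_integralCurve [ProperSpace E] (hV : ContDiff ℝ 1 V) (hF : IsFlow V F)
    {f : ℝ → E} (hf : ∀ t, HasDerivAt f (V (f t)) t) (t : ℝ) : f t = F t (f 0) :=
  eq_of_hasDerivAt hV (t₀ := 0) hf (hF.ode (f 0)) (hF.zero _).symm t

theorem add [ProperSpace E] (hV : ContDiff ℝ 1 V) (hF : IsFlow V F) (s t : ℝ) (y : E) :
    F (s + t) y = F s (F t y) := by
  have h := hF.eq_of_integralCurve hV (f := fun r => F (r + t) y)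
    (fun r => (hF.ode y (r + t)).comp_add_const r t) s
  simpa using h

/-- The flow is jointly continuous near time `0`: by uniqueness it agrees there with the local
flow given by the Picard–Lindelöf theorem. -/
theorem exists_continuousOn [ProperSpace E] (hV : ContDiff ℝ 1 V) (hF : IsFlow V F) (x : E) :
    ∃ ε > 0, ∃ r > 0, ContinuousOn (fun p : E × ℝ => F p.2 p.1)
      (closedBall x r ×ˢ Icc (-ε) ε) := by
  obtain ⟨ε, hε, a, r, L, K, hr, h⟩ := IsPicardLindelof.of_contDiffAt_one (hV.contDiffAt (x := x))
  obtain ⟨α, hα, hc⟩ := (h 0).exists_forall_mem_closedBall_eq_hasDerivWithinAt_continuousOn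
  simp only [zero_sub, zero_add] at hα hc
  refine ⟨ε, hε, r, hr, hc.congr fun p hp => ?_⟩
  refine eqOn_Icc_of_hasDerivWithinAt hV (t₀ := 0) ⟨by linarith, hε⟩
    (fun t _ => (hF.ode p.1 t).hasDerivWithinAt) (hα p.1 hp.1).2 ?_ hp.2
  rw [hF.zero, (hα p.1 hp.1).1]

/-- A complete flow is jointly continuous: for a fixed initial point, the set of times at which
joint continuity holds is open and closed, by the group law and continuity near time `0`. -/
theorem continuous [ProperSpace E] (hV : ContDiff ℝ 1 V) (hF : IsFlow V F) :
    Continuous fun p : E × ℝ => F p.2 p.1 := by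
  refine continuous_iff_continuousAt.2 fun ⟨y, t⟩ => ?_
  let S : Set ℝ := {t | ContinuousAt (fun p : E × ℝ => F p.2 p.1) (y, t)}
  have key : ∀ t, ∀ᶠ t' in 𝓝 t, ∀ᶠ t'' in 𝓝 t, t' ∈ S → t'' ∈ S := by
    intro t
    obtain ⟨ε, hε, r, hr, hc⟩ := hF.exists_continuousOn hV (F t y)
    have h1 : ∀ᶠ t' in 𝓝 t, F t' y ∈ ball (F t y) r :=
      (hF.continuous_time y).continuousAt.eventually (ball_mem_nhds _ hr)
    have h2 : ∀ᶠ t' in 𝓝 t, t' ∈ ball t (ε / 2) := ball_mem_nhds _ (by positivity)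
    filter_upwards [h1, h2] with t' ht1 ht2
    filter_upwards [h2] with t'' ht3 hS
    have hat : ContinuousAt (fun p : E × ℝ => F p.2 p.1) (F t' y, t'' - t') := by
      refine hc.continuousAt (prod_mem_nhds ?_ ?_)
      · exact mem_of_superset (isOpen_ball.mem_nhds ht1) ball_subset_closedBall
      · rw [mem_ball, Real.dist_eq, abs_lt] at ht2 ht3
        exact Icc_mem_nhds (by linarith) (by linarith)
    have hin : ContinuousAt (fun p : E × ℝ => (F t' p.1, p.2 - t')) (y, t'') := by
      refine ContinuousAt.prodMk ?_ (by fun_prop)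
      have h3 : ContinuousAt (fun p : E × ℝ => ((p.1, t') : E × ℝ)) (y, t'') := by fun_prop
      exact ContinuousAt.comp (g := fun p : E × ℝ => F p.2 p.1)
        (f := fun p : E × ℝ => (p.1, t')) (x := (y, t'')) hS h3
    have heq : (fun p : E × ℝ => F p.2 p.1) = fun p => F (p.2 - t') (F t' p.1) := by
      funext p
      rw [← hF.add hV, sub_add_cancel]
    change ContinuousAt (fun p : E × ℝ => F p.2 p.1) (y, t'')
    rw [heq]
    exact ContinuousAt.comp (g := fun p : E × ℝ => F p.2 p.1) (x := (y, t'')) hat hin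
  have hclopen : IsClopen S := by
    constructor
    · rw [← isOpen_compl_iff, isOpen_iff_mem_nhds]
      intro t ht
      filter_upwards [key t] with t' h hS
      exact ht (h.self_of_nhds hS)
    · rw [isOpen_iff_mem_nhds]
      intro t ht
      filter_upwards [(key t).self_of_nhds] with t' h
      exact h ht
  have h0 : (0 : ℝ) ∈ S := by
    obtain ⟨ε, hε, r, hr, hc⟩ := hF.exists_continuousOn hV y
    exact hc.continuousAt (prod_mem_nhds (closedBall_mem_nhds _ hr) (Icc_mem_nhds (by linarith) hε))
  have ht : t ∈ S := hclopen.eq_univ ⟨0, h0⟩ ▸ mem_univ t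
  exact ht

/-- The tangent vectors `W` at the points of an orbit of `F` are transported into each other by `F`
if `W` commutes with the generator `V` of `F`. No differentiability of `F` in the initial point is
needed: with `c r = F r y`, the curve `c r + s W (c r)` solves the equation of `F` up to an error
`O(s ^ 2)`, so that Grönwall's inequality compares it with `F r (H s y)`. -/
theorem hasDerivAt_comp_of_commute [ProperSpace E] {V W : E → E} {F H : ℝ → E → E}
    (hV : ContDiff ℝ 2 V) (hW : ContDiff ℝ 2 W) (hF : IsFlow V F) (hH : IsFlow W H)
    (hVW : ∀ y, fderiv ℝ W y (V y) = fderiv ℝ V y (W y)) {T : ℝ} (hT : 0 ≤ T) (y : E) :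
    HasDerivAt (fun s => F T (H s y)) (W (F T y)) 0 := by
  have hV1 : ContDiff ℝ 1 V := hV.of_le one_le_two
  have hW1 : ContDiff ℝ 1 W := hW.of_le one_le_two
  -- a ball containing all the curves that occur, for `|s| ≤ 1`
  have hc1 : Continuous fun p : ℝ × ℝ => F p.1 (H p.2 y) :=
    (hF.continuous hV1).comp (f := fun p : ℝ × ℝ => (H p.2 y, p.1))
      (((hH.continuous_time y).comp continuous_snd).prodMk continuous_fst)
  have hc2 : Continuous fun p : ℝ × ℝ => F p.1 y + p.2 • W (F p.1 y) :=
    ((hF.continuous_time y).comp continuous_fst).add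
      (continuous_snd.smul (hW.continuous.comp ((hF.continuous_time y).comp continuous_fst)))
  have hcpt : IsCompact (Icc (0 : ℝ) T ×ˢ Icc (-1 : ℝ) 1) := isCompact_Icc.prod isCompact_Icc
  obtain ⟨R, hR⟩ := ((hcpt.image hc1).union (hcpt.image hc2)).isBounded.subset_closedBall 0
  have hR1 : ∀ r ∈ Icc 0 T, ∀ s ∈ Icc (-1 : ℝ) 1, F r (H s y) ∈ closedBall (0 : E) R :=
    fun r hr s hs => hR (Or.inl ⟨(r, s), ⟨hr, hs⟩, rfl⟩)
  have hR2 : ∀ r ∈ Icc 0 T, ∀ s ∈ Icc (-1 : ℝ) 1, F r y + s • W (F r y) ∈ closedBall (0 : E) R :=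
    fun r hr s hs => hR (Or.inr ⟨(r, s), ⟨hr, hs⟩, rfl⟩)
  have hR0 : ∀ r ∈ Icc 0 T, F r y ∈ closedBall (0 : E) R := fun r hr => by
    simpa using hR2 r hr 0 (by simp)
  obtain ⟨K, hK⟩ := exists_lipschitzOnWith_closedBall hV1 R
  obtain ⟨K₂, hK₂⟩ := exists_lipschitzOnWith_closedBall
    (hV.fderiv_right (m := 1) (by norm_num)) R
  obtain ⟨C, hC⟩ := (isCompact_closedBall (0 : E) R).exists_bound_of_continuousOn
    hW.continuous.continuousOn
  have hC0 : 0 ≤ C := (norm_nonneg _).trans (hC _ (hR0 0 ⟨le_rfl, hT⟩))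
  -- the error term of the approximate solution
  have herr : ∀ r ∈ Icc 0 T, ∀ s ∈ Icc (-1 : ℝ) 1,
      ‖V (F r y) + s • fderiv ℝ W (F r y) (V (F r y)) - V (F r y + s • W (F r y))‖
        ≤ K₂ * C ^ 2 * s ^ 2 := by
    intro r hr s hs
    set x := F r y
    have hseg : segment ℝ x (x + s • W x) ⊆ closedBall (0 : E) R :=
      (convex_closedBall _ _).segment_subset (hR0 r hr) (hR2 r hr s hs)
    have hb : ∀ z ∈ segment ℝ x (x + s • W x),
        ‖fderiv ℝ V z - fderiv ℝ V x‖ ≤ K₂ * (|s| * C) := by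
      intro z hz
      have h1 := hK₂.norm_sub_le (hseg hz) (hR0 r hr)
      have h2 : ‖z - x‖ ≤ ‖(x + s • W x) - x‖ := norm_sub_le_of_mem_segment hz
      rw [add_sub_cancel_left, norm_smul, Real.norm_eq_abs] at h2
      refine h1.trans (mul_le_mul_of_nonneg_left (h2.trans ?_) K₂.2)
      exact mul_le_mul_of_nonneg_left (hC _ (hR0 r hr)) (abs_nonneg s)
    have h := (convex_segment x (x + s • W x)).norm_image_sub_le_of_norm_hasFDerivWithin_le'
      (f := V) (φ := fderiv ℝ V x)
      (fun z _ => ((hV1.differentiable one_ne_zero z).hasFDerivAt).hasFDerivWithinAt) hb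
      (left_mem_segment _ _ _) (right_mem_segment _ _ _)
    rw [add_sub_cancel_left, map_smul, ← hVW, norm_smul, Real.norm_eq_abs] at h
    rw [← norm_neg]
    calc _ = ‖V (x + s • W x) - V x - s • fderiv ℝ W x (V x)‖ := by congr 1; abel
      _ ≤ K₂ * (|s| * C) * (|s| * ‖W x‖) := h
      _ ≤ K₂ * (|s| * C) * (|s| * C) := by
        have := hC _ (hR0 r hr)
        gcongr
      _ = K₂ * C ^ 2 * s ^ 2 := by rw [← sq_abs s]; ring
  -- Grönwall's inequality, with the constant `K + 1` in place of `K` because it is not zero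
  have hL : ∀ z ∈ Ico (0 : ℝ) T, LipschitzOnWith (K + 1) V (closedBall (0 : E) R) :=
    fun _ _ => hK.weaken (le_add_of_nonneg_right zero_le_one)
  have hgron : ∀ s ∈ Icc (-1 : ℝ) 1, ‖F T (H s y) - F T y - s • W (F T y)‖ ≤
      gronwallBound ‖H s y - y - s • W y‖ (K + 1 : NNReal) (K₂ * C ^ 2 * s ^ 2) T := by
    intro s hs
    have hd : ∀ r, HasDerivAt (fun r => F r y + s • W (F r y))
        (V (F r y) + s • fderiv ℝ W (F r y) (V (F r y))) r := fun r =>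
      (hF.ode y r).add ((((hW1.differentiable one_ne_zero _).hasFDerivAt.comp_hasDerivAt r
        (hF.ode y r))).const_smul s)
    have h := dist_le_of_approx_trajectories_ODE_of_mem (v := fun _ => V)
      (s := fun _ => closedBall (0 : E) R) (a := 0) (b := T) (f := fun r => F r (H s y))
      (g := fun r => F r y + s • W (F r y)) (f' := fun r => V (F r (H s y)))
      (δ := ‖H s y - y - s • W y‖) (εf := 0)
      hL (hF.continuous_time _).continuousOn (fun r _ => (hF.ode _ r).hasDerivWithinAt)
      (fun r _ => (dist_self _).le) (fun r hr => hR1 r (Ico_subset_Icc_self hr) s hs)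
      (fun r _ => (hd r).continuousAt.continuousWithinAt) (fun r _ => (hd r).hasDerivWithinAt)
      (fun r hr => (dist_eq_norm _ _).trans_le (herr r (Ico_subset_Icc_self hr) s hs))
      (fun r hr => hR2 r (Ico_subset_Icc_self hr) s hs)
      (by rw [hF.zero, hF.zero, dist_eq_norm, sub_add_eq_sub_sub]) T ⟨hT, le_rfl⟩
    rw [dist_eq_norm, sub_add_eq_sub_sub, zero_add, sub_zero] at h
    exact h
  have hlo : (fun s => H s y - y - s • W y) =o[𝓝 0] fun s : ℝ => s := by
    have := hasDerivAt_iff_isLittleO.1 (hH.ode y 0)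
    simpa [hH.zero] using this
  rw [hasDerivAt_iff_isLittleO]
  simp only [sub_zero, hH.zero]
  have hsq : (fun s : ℝ => s ^ 2) =o[𝓝 0] fun s : ℝ => s := by
    simpa using Asymptotics.isLittleO_pow_id (𝕜 := ℝ) one_lt_two
  have hKne : ((K + 1 : NNReal) : ℝ) ≠ 0 := by positivity
  have hbig : (fun s => gronwallBound ‖H s y - y - s • W y‖ (K + 1 : NNReal) (K₂ * C ^ 2 * s ^ 2) T)
      =o[𝓝 0] fun s : ℝ => s := by
    simp only [gronwallBound_of_K_ne_0 hKne]
    refine Asymptotics.IsLittleO.add ?_ ?_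
    · simp only [mul_comm _ (Real.exp _)]
      exact hlo.norm_left.const_mul_left _
    · have : (fun s : ℝ => K₂ * C ^ 2 * s ^ 2 / ((K + 1 : NNReal) : ℝ) *
          (Real.exp (((K + 1 : NNReal) : ℝ) * T) - 1)) = fun s : ℝ => (K₂ * C ^ 2 /
            ((K + 1 : NNReal) : ℝ) * (Real.exp (((K + 1 : NNReal) : ℝ) * T) - 1)) * s ^ 2 := by
        funext s; ring
      rw [this]
      exact hsq.const_mul_left _
  refine Asymptotics.IsBigO.trans_isLittleO (Asymptotics.IsBigO.of_bound 1 ?_) hbig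
  filter_upwards [Icc_mem_nhds (show (-1 : ℝ) < 0 by norm_num) one_pos] with s hs
  rw [one_mul]
  exact (hgron s hs).trans (le_abs_self _)

/-- Complete flows of commuting vector fields commute. -/
theorem comm [ProperSpace E] {V W : E → E} {F H : ℝ → E → E}
    (hV : ContDiff ℝ 2 V) (hW : ContDiff ℝ 2 W) (hF : IsFlow V F) (hH : IsFlow W H)
    (hVW : ∀ y, fderiv ℝ W y (V y) = fderiv ℝ V y (W y)) (s t : ℝ) (y : E) :
    F t (H s y) = H s (F t y) := by
  have hV1 : ContDiff ℝ 1 V := hV.of_le one_le_two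
  have hW1 : ContDiff ℝ 1 W := hW.of_le one_le_two
  have pos : ∀ T : ℝ, 0 ≤ T → ∀ y, F T (H s y) = H s (F T y) := by
    intro T hT y
    have hd : ∀ r, HasDerivAt (fun r => F T (H r y)) (W (F T (H r y))) r := by
      intro r
      have h := hasDerivAt_comp_of_commute hV hW hF hH hVW hT (H r y)
      have h2 : HasDerivAt (fun s => F T (H (s - r) (H r y))) (W (F T (H r y))) r :=
        HasDerivAt.comp_sub_const r r (by rwa [sub_self])
      simpa only [← hH.add hW1, sub_add_cancel] using h2
    have := hH.eq_of_integralCurve hW1 hd s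
    simpa [hH.zero] using this
  rcases le_total 0 t with ht | ht
  · exact pos t ht y
  · have h := pos (-t) (by linarith) (F t y)
    have h3 : F (-t) (F t y) = y := by rw [← hF.add hV1, neg_add_cancel, hF.zero]
    rw [h3] at h
    rw [← h, ← hF.add hV1, add_neg_cancel, hF.zero]

end IsFlow

end Flow

/-! ### Multi-time maps of commuting flows -/

section MultiTime

variable {α β : Type*}

theorem multiTime_succ {m : ℕ} (F : Fin (m + 1) → ℝ → α → α) (t : Fin (m + 1) → ℝ) (y : α) :
    multiTime F t y = multiTime (fun j => F j.succ) (fun j => t j.succ) (F 0 (t 0) y) :=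
  Fin.foldl_succ _ _

theorem multiTime_semiconj {m : ℕ} {F : Fin m → ℝ → α → α} {F' : Fin m → ℝ → β → β} {p : α → β}
    (h : ∀ j r y, p (F j r y) = F' j r (p y)) (t : Fin m → ℝ) (y : α) :
    p (multiTime F t y) = multiTime F' t (p y) := by
  induction m generalizing y with
  | zero => rfl
  | succ m ih => rw [multiTime_succ, multiTime_succ, ih (fun j => h j.succ), h]

/-- `F_1, …, F_m` are pairwise commuting actions of the additive group `ℝ`. -/
structure IsCommutingActions {m : ℕ} (F : Fin m → ℝ → α → α) : Prop where
  zero : ∀ j y, F j 0 y = y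
  add : ∀ j s t y, F j (s + t) y = F j s (F j t y)
  comm : ∀ j k s t y, F j s (F k t y) = F k t (F j s y)

namespace IsCommutingActions

variable {m : ℕ}

theorem tail {F : Fin (m + 1) → ℝ → α → α} (hF : IsCommutingActions F) :
    IsCommutingActions fun j : Fin m => F j.succ :=
  ⟨fun _ => hF.zero _, fun _ => hF.add _, fun _ _ => hF.comm _ _⟩

theorem multiTime_zero {F : Fin m → ℝ → α → α} (hF : IsCommutingActions F) (y : α) :
    multiTime F 0 y = y := by
  induction m generalizing y with
  | zero => rfl
  | succ m ih =>
    rw [multiTime_succ, Pi.zero_apply, hF.zero]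
    exact ih hF.tail y

theorem multiTime_add {F : Fin m → ℝ → α → α} (hF : IsCommutingActions F) (s t : Fin m → ℝ)
    (y : α) : multiTime F (s + t) y = multiTime F s (multiTime F t y) := by
  induction m generalizing y with
  | zero => rfl
  | succ m ih =>
    simp only [multiTime_succ, Pi.add_apply, hF.add]
    have h := ih hF.tail (fun j => s j.succ) (fun j => t j.succ) (F 0 (s 0) (F 0 (t 0) y))
    refine h.trans ?_
    rw [multiTime_semiconj (F' := fun j : Fin m => F j.succ) (p := F 0 (s 0))
      (fun j r y => hF.comm _ _ _ _ _)]

theorem multiTime_add_comm {F : Fin m → ℝ → α → α} (hF : IsCommutingActions F)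
    (s t : Fin m → ℝ) (y : α) :
    multiTime F s (multiTime F t y) = multiTime F t (multiTime F s y) := by
  rw [← hF.multiTime_add, add_comm, hF.multiTime_add]

theorem multiTime_neg {F : Fin m → ℝ → α → α} (hF : IsCommutingActions F) (t : Fin m → ℝ)
    (y : α) : multiTime F (-t) (multiTime F t y) = y := by
  rw [← hF.multiTime_add, neg_add_cancel, hF.multiTime_zero]

end IsCommutingActions

/-- The linear map `h ↦ ∑ j, h_j V_j(y)`. -/
noncomputable def combination {E : Type*} [NormedAddCommGroup E] [NormedSpace ℝ E] {m : ℕ}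
    (V : Fin m → E → E) (y : E) : (Fin m → ℝ) →L[ℝ] E :=
  ∑ j, (ContinuousLinearMap.proj j : (Fin m → ℝ) →L[ℝ] ℝ).smulRight (V j y)

theorem combination_apply {E : Type*} [NormedAddCommGroup E] [NormedSpace ℝ E] {m : ℕ}
    (V : Fin m → E → E) (y : E)
    (h : Fin m → ℝ) :
    combination V y h = ∑ j, h j • V j y := by
  simp [combination]

theorem contDiff_combination {E : Type*} [NormedAddCommGroup E] [NormedSpace ℝ E] {m : ℕ}
    {V : Fin m → E → E} {k : WithTop ℕ∞} (hV : ∀ j, ContDiff ℝ k (V j)) :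
    ContDiff ℝ k (combination V) :=
  ContDiff.sum fun j _ => contDiff_const.smulRight (hV j)

/-- A family of complete flows of pairwise commuting vector fields. Class `C^2` makes the
derivatives of the fields locally Lipschitz, which `IsFlow.hasDerivAt_comp_of_commute` uses. -/
structure IsCommutingFlows {E : Type*} [NormedAddCommGroup E] [NormedSpace ℝ E] {m : ℕ}
    (V : Fin m → E → E) (F : Fin m → ℝ → E → E) : Prop where
  contDiff : ∀ j, ContDiff ℝ 2 (V j)
  isFlow : ∀ j, IsFlow (V j) (F j)
  commute : ∀ j k y, fderiv ℝ (V k) y (V j y) = fderiv ℝ (V j) y (V k y)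

namespace IsCommutingFlows

variable {E : Type*} [NormedAddCommGroup E] [NormedSpace ℝ E] {m : ℕ}

theorem tail {V : Fin (m + 1) → E → E} {F : Fin (m + 1) → ℝ → E → E}
    (h : IsCommutingFlows V F) :
    IsCommutingFlows (fun j : Fin m => V j.succ) fun j : Fin m => F j.succ :=
  ⟨fun _ => h.contDiff _, fun _ => h.isFlow _, fun _ _ => h.commute _ _⟩

theorem contDiff_one {V : Fin m → E → E} {F : Fin m → ℝ → E → E} (h : IsCommutingFlows V F)
    (j : Fin m) : ContDiff ℝ 1 (V j) :=
  (h.contDiff j).of_le one_le_two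

theorem isCommutingActions [ProperSpace E] {V : Fin m → E → E} {F : Fin m → ℝ → E → E}
    (h : IsCommutingFlows V F) : IsCommutingActions F where
  zero j := (h.isFlow j).zero
  add j := (h.isFlow j).add (h.contDiff_one j)
  comm j k s t y := IsFlow.comm (h.contDiff j) (h.contDiff k) (h.isFlow j) (h.isFlow k)
    (h.commute j k) t s y

theorem continuous_multiTime [ProperSpace E] {V : Fin m → E → E} {F : Fin m → ℝ → E → E}
    (h : IsCommutingFlows V F) : Continuous fun p : (Fin m → ℝ) × E => multiTime F p.1 p.2 := by
  induction m with
  | zero => exact continuous_snd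
  | succ m ih =>
    simp only [multiTime_succ]
    exact (ih h.tail).comp (f := fun p : (Fin (m + 1) → ℝ) × E =>
      ((fun j => p.1 j.succ : Fin m → ℝ), F 0 (p.1 0) p.2))
      ((by fun_prop : Continuous fun p : (Fin (m + 1) → ℝ) × E =>
          fun j : Fin m => p.1 j.succ).prodMk
        (((h.isFlow 0).continuous (h.contDiff_one 0)).comp
          (f := fun p : (Fin (m + 1) → ℝ) × E => (p.2, p.1 0)) (by fun_prop)))

/-- The multi-time map is strictly differentiable in time. The induction on the number of flows
splits off the first time variable and uses that a function with continuous partial derivatives is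
strictly differentiable. -/
theorem hasStrictFDerivAt_multiTime [ProperSpace E] {V : Fin m → E → E} {F : Fin m → ℝ → E → E}
    (h : IsCommutingFlows V F) (y : E) (t : Fin m → ℝ) :
    HasStrictFDerivAt (fun t => multiTime F t y) (combination V (multiTime F t y)) t := by
  induction m generalizing y with
  | zero =>
    have : (fun t : Fin 0 → ℝ => multiTime F t y) = fun _ => multiTime F t y := by
      funext s; rw [Subsingleton.elim s t]
    rw [this]
    refine (hasStrictFDerivAt_const _ _).congr_fderiv ?_
    ext v
    simp [combination_apply]
  | succ m ih =>
    let f : ℝ → (Fin m → ℝ) → E := fun a b => multiTime (fun j : Fin m => F j.succ) b (F 0 a y)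
    have hcf : Continuous fun p : ℝ × (Fin m → ℝ) => f p.1 p.2 :=
      h.tail.continuous_multiTime.comp (f := fun p : ℝ × (Fin m → ℝ) => (p.2, F 0 p.1 y))
        (continuous_snd.prodMk (((h.isFlow 0).continuous_time y).comp continuous_fst))
    let f₁ : ℝ → (Fin m → ℝ) → ℝ →L[ℝ] E := fun a b =>
      (1 : ℝ →L[ℝ] ℝ).smulRight (V 0 (f a b))
    let f₂ : ℝ → (Fin m → ℝ) → (Fin m → ℝ) →L[ℝ] E := fun a b =>
      combination (fun j : Fin m => V j.succ) (f a b)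
    have hf₁ : ∀ a b, HasFDerivAt (fun a => f a b) (f₁ a b) a := by
      intro a b
      have hsc : ∀ a, f a b = F 0 a (multiTime (fun j : Fin m => F j.succ) b y) := fun a =>
        (multiTime_semiconj (F' := fun j : Fin m => F j.succ) (p := F 0 a)
          (fun j r y => h.isCommutingActions.comm _ _ _ _ _) b y).symm
      have := (h.isFlow 0).ode (multiTime (fun j : Fin m => F j.succ) b y) a
      simp only [← hsc] at this
      exact hasDerivAt_iff_hasFDerivAt.1 this
    have hf₂ : ∀ a b, HasFDerivAt (fun b => f a b) (f₂ a b) b := fun a b =>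
      (ih h.tail (F 0 a y) b).hasFDerivAt
    have hs := hasStrictFDerivAt_uncurry_coprod (𝕜 := ℝ) (f := f) (f₁ := f₁) (f₂ := f₂)
      (u := (t 0, fun j => t j.succ))
      (Eventually.of_forall fun v => hf₁ v.1 v.2) (Eventually.of_forall fun v => hf₂ v.1 v.2)
      ((contDiff_const.smulRight (h.contDiff_one 0)).continuous.comp hcf).continuousAt
      ((contDiff_combination h.tail.contDiff_one).continuous.comp hcf).continuousAt
    let L : (Fin (m + 1) → ℝ) →L[ℝ] ℝ × (Fin m → ℝ) :=
      (ContinuousLinearMap.proj 0).prod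
        (ContinuousLinearMap.pi fun j => ContinuousLinearMap.proj j.succ)
    have hL := HasStrictFDerivAt.comp (f := L) t hs L.hasStrictFDerivAt
    simp only [multiTime_succ]
    refine hL.congr_fderiv ?_
    ext v
    simp [L, f₁, f₂, Function.HasUncurry.uncurry, combination_apply, Fin.sum_univ_succ, f]

/-- A curve whose velocity is a time dependent linear combination, with coefficients `u_j`, of
commuting vector fields ends at the image of its starting point under the multi-time map for the
times `∫ u_j`. -/
theorem eq_multiTime_integral [ProperSpace E] {V : Fin m → E → E} {F : Fin m → ℝ → E → E}
    (h : IsCommutingFlows V F) {u : ℝ → Fin m → ℝ} (hu : ContinuousOn u (Icc 0 1)) {f : ℝ → E}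
    (hf : ∀ t ∈ Icc (0 : ℝ) 1, HasDerivWithinAt f (∑ j, u t j • V j (f t)) (Icc 0 1) t) :
    f 1 = multiTime F (∫ t in (0 : ℝ)..1, u t) (f 0) := by
  set v : ℝ → Fin m → ℝ := IccExtend zero_le_one ((Icc 0 1).domRestrict u) with hv
  have hvc : Continuous v := (continuousOn_iff_continuous_domRestrict.1 hu).Icc_extend'
  have hvu : ∀ t ∈ Icc (0 : ℝ) 1, v t = u t := fun t ht => by
    rw [hv, IccExtend_of_mem _ _ ht, domRestrict_apply]
  have hint : ∫ t in (0 : ℝ)..1, u t = ∫ t in (0 : ℝ)..1, v t :=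
    intervalIntegral.integral_congr fun t ht => (hvu t (by rwa [uIcc_of_le zero_le_one] at ht)).symm
  let T : ℝ → Fin m → ℝ := fun t => ∫ s in (0 : ℝ)..t, v s
  have hT : ∀ t, HasDerivAt T (v t) t := fun t => (hvc.integral_hasStrictDerivAt 0 t).hasDerivAt
  let g : ℝ → E := fun t => multiTime F (T t) (f 0)
  have hg : ∀ t, HasDerivAt g (∑ j, v t j • V j (g t)) t := fun t => by
    have := (h.hasStrictFDerivAt_multiTime (f 0) (T t)).hasFDerivAt.comp_hasDerivAt t (hT t)
    rwa [combination_apply] at this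
  have hgc : ContinuousOn g (Icc 0 1) := fun t _ => (hg t).continuousAt.continuousWithinAt
  have hfc : ContinuousOn f (Icc 0 1) := fun t ht => (hf t ht).continuousWithinAt
  obtain ⟨R, hR⟩ := ((isCompact_Icc.image_of_continuousOn hfc).union
    (isCompact_Icc.image_of_continuousOn hgc)).isBounded.subset_closedBall 0
  obtain ⟨C, hC⟩ := isCompact_Icc.exists_bound_of_continuousOn hvc.continuousOn (s := Icc 0 1)
  choose K hK using fun j => exists_lipschitzOnWith_closedBall (h.contDiff_one j) R
  have hlip : ∀ t ∈ Ico (0 : ℝ) 1, LipschitzOnWith (∑ j, C.toNNReal * K j)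
      (fun y => ∑ j, v t j • V j y) (closedBall 0 R) := by
    intro t ht
    refine LipschitzOnWith.of_dist_le_mul fun x hx y hy => ?_
    rw [dist_eq_norm, ← Finset.sum_sub_distrib]
    refine (norm_sum_le _ _).trans ?_
    rw [NNReal.coe_sum, Finset.sum_mul]
    refine Finset.sum_le_sum fun j _ => ?_
    rw [← smul_sub, norm_smul, NNReal.coe_mul, mul_assoc]
    refine mul_le_mul ?_ ?_ (norm_nonneg _) (NNReal.coe_nonneg _)
    · exact ((norm_le_pi_norm (v t) j).trans (hC t (Ico_subset_Icc_self ht))).trans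
        (Real.le_coe_toNNReal C)
    · rw [← dist_eq_norm]
      exact (hK j).dist_le_mul x hx y hy
  have hfr : ∀ t ∈ Ico (0 : ℝ) 1, HasDerivWithinAt f (∑ j, v t j • V j (f t)) (Ici t) t := by
    intro t ht
    rw [hvu t (Ico_subset_Icc_self ht)]
    exact (hf t (Ico_subset_Icc_self ht)).mono_of_mem_nhdsWithin (Icc_mem_nhdsGE_of_mem ht)
  have hfg := ODE_solution_unique_of_mem_Icc_right hlip hfc hfr
    (fun t ht => hR (Or.inl (mem_image_of_mem f (Ico_subset_Icc_self ht)))) hgc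
    (fun t _ => (hg t).hasDerivWithinAt)
    (fun t ht => hR (Or.inr (mem_image_of_mem g (Ico_subset_Icc_self ht))))
    (by simp [g, T, h.isCommutingActions.multiTime_zero])
  rw [hint]
  exact hfg ⟨zero_le_one, le_rfl⟩

end IsCommutingFlows

end MultiTime

/-! ### Hamiltonian vector fields in involution -/

section Involution

variable {d : ℕ}

/-- The linear isomorphism that takes the differential of a function to its Hamiltonian vector. -/
noncomputable def symplecticMap : (Phase d →L[ℝ] ℝ) →L[ℝ] Phase d :=
  (ContinuousLinearMap.pi fun i =>
      -ContinuousLinearMap.apply ℝ ℝ ((0, Pi.single i 1) : Phase d)).prod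
    (ContinuousLinearMap.pi fun i => ContinuousLinearMap.apply ℝ ℝ ((Pi.single i 1, 0) : Phase d))

theorem symplecticMap_fderiv (f : Phase d → ℝ) (z : Phase d) :
    symplecticMap (fderiv ℝ f z) = hamVec f z := rfl

theorem apply_eq_sum (ℓ : Phase d →L[ℝ] ℝ) (v : Phase d) :
    ℓ v = ∑ i, (v.1 i * ℓ (Pi.single i 1, 0) + v.2 i * ℓ (0, Pi.single i 1)) := by
  have h : v = ∑ i, (v.1 i • ((Pi.single i 1, 0) : Phase d)
      + v.2 i • ((0, Pi.single i 1) : Phase d)) := by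
    ext k <;> simp [Finset.sum_apply, Prod.fst_sum, Prod.snd_sum, Pi.single_apply]
  conv_lhs => rw [h, map_sum]
  simp only [map_add, map_smul, smul_eq_mul]

theorem apply_symplecticMap (ℓ m : Phase d →L[ℝ] ℝ) :
    m (symplecticMap ℓ) = -ℓ (symplecticMap m) := by
  rw [apply_eq_sum m, apply_eq_sum ℓ, ← Finset.sum_neg_distrib]
  refine Finset.sum_congr rfl fun i _ => ?_
  simp only [symplecticMap, ContinuousLinearMap.prod_apply, ContinuousLinearMap.coe_pi',
    neg_apply, ContinuousLinearMap.apply_apply]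
  ring

theorem symplecticMap_injective :
    Function.Injective (symplecticMap : (Phase d →L[ℝ] ℝ) → Phase d) := by
  rw [injective_iff_map_eq_zero]
  intro ℓ h
  refine ContinuousLinearMap.ext fun v => ?_
  have h2 : ∀ i, ℓ (0, Pi.single i 1) = 0 := fun i => by
    have := congrFun (congrArg Prod.fst h) i
    exact neg_eq_zero.1 this
  have h1 : ∀ i, ℓ (Pi.single i 1, 0) = 0 := fun i => congrFun (congrArg Prod.snd h) i
  rw [apply_eq_sum]
  simp [h1, h2]

theorem contDiff_hamVec {f : Phase d → ℝ} (hf : ContDiff ℝ ∞ f) : ContDiff ℝ ∞ (hamVec f) :=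
  symplecticMap.contDiff.comp (hf.fderiv_right (m := ∞) (by simp))

theorem fderiv_hamVec_eq {f : Phase d → ℝ} (hf : ContDiff ℝ ∞ f) (z v : Phase d) :
    fderiv ℝ (hamVec f) z v = symplecticMap (fderiv ℝ (fderiv ℝ f) z v) := by
  have h : DifferentiableAt ℝ (fderiv ℝ f) z :=
    (hf.fderiv_right (m := ∞) (by simp)).differentiable (by simp) z
  have := (symplecticMap.hasFDerivAt.comp z h.hasFDerivAt).fderiv
  exact congrArg (fun L => L v) this

/-- The Hamiltonian vector fields of two functions in involution commute. -/
theorem fderiv_hamVec_comm {f g : Phase d → ℝ} (hf : ContDiff ℝ ∞ f) (hg : ContDiff ℝ ∞ g)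
    (h : ∀ z, bracket f g z = 0) (z : Phase d) :
    fderiv ℝ (hamVec g) z (hamVec f z) = fderiv ℝ (hamVec f) z (hamVec g z) := by
  rw [fderiv_hamVec_eq hf, fderiv_hamVec_eq hg]
  congr 1
  refine ContinuousLinearMap.ext fun w => ?_
  have hsym : ∀ {f : Phase d → ℝ}, ContDiff ℝ ∞ f → ∀ u v,
      fderiv ℝ (fderiv ℝ f) z u v = fderiv ℝ (fderiv ℝ f) z v u := fun {f} hf u v =>
    ((contDiff_infty.1 hf 2).contDiffAt.isSymmSndFDerivAt (by simp)).eq u v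
  -- differentiate the identity `dg (X_f) = 0` in the direction `w`
  have hd : HasFDerivAt (fun z => fderiv ℝ g z (hamVec f z))
      ((fderiv ℝ g z).comp (fderiv ℝ (hamVec f) z) +
        (fderiv ℝ (fderiv ℝ g) z).flip (hamVec f z)) z :=
    ((hg.fderiv_right (m := ∞) (by simp)).differentiable (by simp) z).hasFDerivAt.clm_apply
      ((contDiff_hamVec hf).differentiable (by simp) z).hasFDerivAt
  have hz : (fun z => fderiv ℝ g z (hamVec f z)) = fun _ => 0 :=
    funext fun z => (fderiv_hamVec f g z).trans (h z)
  rw [hz] at hd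
  have h0 := congrArg (fun L => L w) (hd.unique (hasFDerivAt_const (0 : ℝ) z))
  simp only [add_apply, ContinuousLinearMap.comp_apply,
    ContinuousLinearMap.flip_apply, zero_apply] at h0
  rw [fderiv_hamVec_eq hf, apply_symplecticMap, symplecticMap_fderiv] at h0
  rw [hsym hg, hsym hf]
  linarith

theorem isCommutingFlows_hamVec {A : Fin d → Phase d → ℝ} {φ : Fin d → ℝ → Phase d → Phase d}
    (hA : ∀ j, ContDiff ℝ ∞ (A j)) (hinv : InInvolution A)
    (hφ : ∀ j, IsHamiltonianFlow (A j) (φ j)) :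
    IsCommutingFlows (fun j => hamVec (A j)) φ where
  contDiff j := contDiff_infty.1 (contDiff_hamVec (hA j)) 2
  isFlow j := ⟨(hφ j).zero, (hφ j).ode⟩
  commute j k := fderiv_hamVec_comm (hA j) (hA k) (hinv j k)

theorem multiTime_mem_levelSet {A : Fin d → Phase d → ℝ} {φ : Fin d → ℝ → Phase d → Phase d}
    (hA : ∀ j, ContDiff ℝ ∞ (A j)) (hinv : InInvolution A)
    (hφ : ∀ j, IsHamiltonianFlow (A j) (φ j)) {a : Fin d → ℝ} {z : Phase d}
    (hz : z ∈ levelSet A a) (t : Fin d → ℝ) : multiTime φ t z ∈ levelSet A a := by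
  have hflow : ∀ j k r z, A k (φ j r z) = A k z := by
    intro j k r z
    have hd : ∀ s, HasDerivAt (fun s => A k (φ j s z)) 0 s := fun s => by
      have := (((hA k).differentiable (by simp) (φ j s z)).hasFDerivAt).comp_hasDerivAt s
        ((hφ j).ode z s)
      rwa [fderiv_hamVec, hinv] at this
    have := is_const_of_deriv_eq_zero (fun s => (hd s).differentiableAt)
      (fun s => (hd s).deriv) r 0
    rwa [(hφ j).zero] at this
  intro k
  have := multiTime_semiconj (p := A k) (F' := fun _ _ x => x) (fun j r y => hflow j k r y) t z
  rw [this, hz k]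
  exact Nat.recOn (motive := fun m => ∀ t : Fin m → ℝ,
    multiTime (fun _ _ x => x) t (a k) = a k) d (fun _ => rfl)
    (fun m ih t => (multiTime_succ _ _ _).trans (ih _)) t

end Involution

/-! ### Group extensions -/

section Extension

variable {d n : ℕ} {G : Subgroup (Matrix.unitaryGroup (Fin n) ℂ)}

theorem toMat_injective : Function.Injective (toMat : G → Mat n) :=
  Subtype.val_injective.comp Subtype.val_injective

/-- The vector field on `ℝ^d × ℝ^d × Mat n` whose flow is the extension of the Hamiltonian flow of
`H` by the transport with generator `M`. -/
noncomputable def extVec (H : Phase d → ℝ) (M : Phase d → lieAlg G) (y : Phase d × Mat n) :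
    Phase d × Mat n :=
  (hamVec H y.1, -((M y.1 : Mat n) * y.2))

/-- The extension of a flow by a transport, on all matrices instead of the group `G` only, so that it
is a flow on a vector space. -/
def matExtension (φ : ℝ → Phase d → Phase d) (D : Phase d → ℝ → G) (t : ℝ)
    (y : Phase d × Mat n) : Phase d × Mat n :=
  (φ t y.1, toMat (D y.1 t) * y.2)

theorem isFlow_matExtension {H : Phase d → ℝ} {φ : ℝ → Phase d → Phase d}
    {M : Phase d → lieAlg G} {D : Phase d → ℝ → G} (hφ : IsHamiltonianFlow H φ)
    (hD : IsTransport φ M D) : IsFlow (extVec H M) (matExtension φ D) where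
  zero y := by simp [matExtension, hφ.zero, hD.zero]
  ode y t := by
    refine ((hφ.ode y.1 t).prodMk ((hD.ode y.1 t).mul_const y.2)).congr_deriv ?_
    simp [extVec, matExtension, mul_assoc]

theorem contDiff_extVec {H : Phase d → ℝ} {M : Phase d → lieAlg G} (hH : ContDiff ℝ ∞ H)
    (hM : ContDiff ℝ ∞ fun z => (M z : Mat n)) : ContDiff ℝ ∞ (extVec H M) :=
  ((contDiff_hamVec hH).comp contDiff_fst).prodMk ((hM.comp contDiff_fst).mul contDiff_snd).neg

theorem fderiv_extVec {H : Phase d → ℝ} {M : Phase d → lieAlg G} (hH : ContDiff ℝ ∞ H)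
    (hM : ContDiff ℝ ∞ fun z => (M z : Mat n)) (y v : Phase d × Mat n) :
    fderiv ℝ (extVec H M) y v = (fderiv ℝ (hamVec H) y.1 v.1,
      -(fderiv ℝ (fun z => (M z : Mat n)) y.1 v.1 * y.2 + (M y.1 : Mat n) * v.2)) := by
  have h1 := ((contDiff_hamVec hH).differentiable (by simp) y.1).hasFDerivAt.comp y
    (hasFDerivAt_fst (𝕜 := ℝ) (p := y))
  have h2 := (hM.differentiable (by simp) y.1).hasFDerivAt.comp y
    (hasFDerivAt_fst (𝕜 := ℝ) (p := y))
  have h3 := h1.prodMk ((h2.mul' (hasFDerivAt_snd (𝕜 := ℝ) (p := y))).neg)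
  have h4 : HasFDerivAt (extVec H M) _ y := h3
  rw [h4.fderiv, add_comm (_ * y.2)]
  rfl

variable {A : Fin d → Phase d → ℝ} {φ : Fin d → ℝ → Phase d → Phase d}
  {M : Fin d → Phase d → lieAlg G} {D : Fin d → Phase d → ℝ → G}

theorem mul_add_mul_neg_eq_of_flat {R : Type*} [Ring R] (a b m k y : R)
    (h : a + -b + (m * k - k * m) = 0) :
    a * y + k * -(m * y) = b * y + m * -(k * y) := by
  have h2 : a = b - (m * k - k * m) := by
    rw [← sub_eq_zero, ← h]
    abel
  rw [h2]
  noncomm_ring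

/-- The bracket condition says exactly that the vector fields of the extensions commute. -/
theorem isCommutingFlows_matExtension (hA : ∀ j, ContDiff ℝ ∞ (A j)) (hinv : InInvolution A)
    (hφ : ∀ j, IsHamiltonianFlow (A j) (φ j)) (hM : ∀ j, ContDiff ℝ ∞ fun z => (M j z : Mat n))
    (hD : ∀ j, IsTransport (φ j) (M j) (D j))
    (hMinv : ∀ j k z,
      bracket (A j) (fun w => (M k w : Mat n)) z + bracketLeft (fun w => (M j w : Mat n)) (A k) z
        + ((M j z : Mat n) * (M k z : Mat n) - (M k z : Mat n) * (M j z : Mat n)) = 0) :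
    IsCommutingFlows (fun j => extVec (A j) (M j)) fun j => matExtension (φ j) (D j) where
  contDiff j := contDiff_infty.1 (contDiff_extVec (hA j) (hM j)) 2
  isFlow j := isFlow_matExtension (hφ j) (hD j)
  commute j k y := by
    refine (fderiv_extVec (hA k) (hM k) y _).trans (Eq.trans ?_
      (fderiv_extVec (hA j) (hM j) y _).symm)
    refine Prod.ext (fderiv_hamVec_comm (hA j) (hA k) (hinv j k) y.1) ?_
    have hl : bracketLeft (fun w => (M j w : Mat n)) (A k) y.1 =
        -bracket (A k) (fun w => (M j w : Mat n)) y.1 := by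
      rw [bracketLeft, bracket, ← Finset.sum_neg_distrib]
      exact Finset.sum_congr rfl fun i _ => (neg_sub _ _).symm
    have h := hMinv j k y.1
    rw [hl, ← fderiv_hamVec, ← fderiv_hamVec] at h
    exact congrArg Neg.neg (mul_add_mul_neg_eq_of_flat _ _ _ _ y.2 h)

theorem map_toMat_extension (φ : ℝ → Phase d → Phase d) (D : Phase d → ℝ → G) (t : ℝ)
    (y : Phase d × G) :
    Prod.map id toMat (extension φ D t y) = matExtension φ D t (Prod.map id toMat y) := rfl

theorem map_toMat_injective :
    Function.Injective (Prod.map id toMat : Phase d × G → Phase d × Mat n) :=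
  Function.injective_id.prodMap toMat_injective

theorem isCommutingActions_extension
    (h : IsCommutingActions fun j => matExtension (φ j) (D j)) :
    IsCommutingActions fun j => extension (φ j) (D j) where
  zero j y := map_toMat_injective (by rw [map_toMat_extension, h.zero])
  add j s t y := map_toMat_injective (by simp only [map_toMat_extension, h.add])
  comm j k s t y := map_toMat_injective (by
    simp only [map_toMat_extension]
    exact h.comm j k s t _)

theorem map_toMat_multiTime (t : Fin d → ℝ) (y : Phase d × G) :
    Prod.map id toMat (multiTime (fun j => extension (φ j) (D j)) t y) =
      multiTime (fun j => matExtension (φ j) (D j)) t (Prod.map id toMat y) :=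
  multiTime_semiconj (fun j => map_toMat_extension (φ j) (D j)) t y

theorem multiTime_extension (t : Fin d → ℝ) (z : Phase d) (g : G) :
    multiTime (fun j => extension (φ j) (D j)) t (z, g) =
      (multiTime φ t z, multiCocycle φ D z t * g) := by
  have h1 := multiTime_semiconj (F := fun j => extension (φ j) (D j)) (F' := φ) (p := Prod.fst)
    (fun j r y => rfl) t (z, g)
  have h2 := multiTime_semiconj (F := fun j => extension (φ j) (D j))
    (F' := fun j => extension (φ j) (D j)) (p := fun y => (y.1, y.2 * g))
    (fun j r y => by simp [extension, mul_assoc]) t (z, 1)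
  rw [one_mul] at h2
  refine Prod.ext h1 ?_
  rw [← h2, multiCocycle]

theorem multiCocycle_add (h : IsCommutingActions fun j => extension (φ j) (D j))
    (s t : Fin d → ℝ) (z : Phase d) :
    multiCocycle φ D z (s + t) = multiCocycle φ D (multiTime φ t z) s * multiCocycle φ D z t := by
  have := h.multiTime_add s t (z, 1)
  simp only [multiTime_extension, mul_one] at this
  exact congrArg Prod.snd this

end Extension

/-! ### The orbits of the multi-time flow on a Liouville–Arnold torus -/

section Torus

variable {d : ℕ} {A : Fin d → Phase d → ℝ} {φ : Fin d → ℝ → Phase d → Phase d} {a : Fin d → ℝ}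

/-- `A_1, …, A_d` are smooth functions in involution, with complete Hamiltonian flows `φ_j`. -/
structure IsIntegrableSystem (A : Fin d → Phase d → ℝ) (φ : Fin d → ℝ → Phase d → Phase d) :
    Prop where
  contDiff : ∀ j, ContDiff ℝ ∞ (A j)
  involution : InInvolution A
  flow : ∀ j, IsHamiltonianFlow (A j) (φ j)

/-- The linear map `h ↦ ∑ j, h_j X_j(z)`, where `X_j` is the Hamiltonian vector field of `A_j`. -/
noncomputable abbrev hamComb (A : Fin d → Phase d → ℝ) (z : Phase d) : (Fin d → ℝ) →L[ℝ] Phase d :=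
  combination (fun j => hamVec (A j)) z

theorem linearIndependent_hamVec {z : Phase d}
    (hz : LinearIndependent ℝ fun j => fderiv ℝ (A j) z) :
    LinearIndependent ℝ fun j => hamVec (A j) z := by
  rw [Fintype.linearIndependent_iff] at hz ⊢
  intro c hc
  refine hz c (symplecticMap_injective ?_)
  rw [map_zero, map_sum, ← hc]
  exact Finset.sum_congr rfl fun j _ => map_smul _ _ _

theorem hamComb_injective {z : Phase d} (hz : LinearIndependent ℝ fun j => fderiv ℝ (A j) z) :
    Function.Injective (hamComb A z) := by
  rw [injective_iff_map_eq_zero]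
  intro h hh
  rw [combination_apply] at hh
  exact funext (Fintype.linearIndependent_iff.1 (linearIndependent_hamVec hz) h hh)

theorem hamComb_mem_tangentAt (hinv : InInvolution A) (z : Phase d) (h : Fin d → ℝ) :
    hamComb A z h ∈ tangentAt A z := by
  rw [combination_apply]
  exact Submodule.sum_mem _ fun j _ => Submodule.smul_mem _ _ (hamVec_mem_tangentAt hinv j z)

/-- At a regular point, the Hamiltonian vectors span the tangent space of the level set: both
spaces have dimension `d`. -/
theorem exists_hamComb_eq (hinv : InInvolution A) {z : Phase d}
    (hz : LinearIndependent ℝ fun j => fderiv ℝ (A j) z) {v : Phase d} (hv : v ∈ tangentAt A z) :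
    ∃ h, hamComb A z h = v := by
  have hle : LinearMap.range (hamComb A z : (Fin d → ℝ) →ₗ[ℝ] Phase d) ≤ tangentAt A z := by
    rintro _ ⟨h, rfl⟩
    exact hamComb_mem_tangentAt hinv z h
  have hrank :
      Module.finrank ℝ (LinearMap.range (hamComb A z : (Fin d → ℝ) →ₗ[ℝ] Phase d)) = d := by
    rw [LinearMap.finrank_range_of_inj (hamComb_injective hz), Module.finrank_fin_fun]
  let dA : Fin d → Module.Dual ℝ (Phase d) := fun j => (fderiv ℝ (A j) z : Phase d →ₗ[ℝ] ℝ)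
  have hdA : LinearIndependent ℝ dA :=
    hz.map' (ContinuousLinearMap.coeLM ℝ : (Phase d →L[ℝ] ℝ) →ₗ[ℝ] _)
      (LinearMap.ker_eq_bot.2 ContinuousLinearMap.coe_injective)
  have htan : tangentAt A z ≤ (Submodule.span ℝ (range dA)).dualCoannihilator := by
    intro w hw
    rw [Submodule.mem_dualCoannihilator]
    intro f hf
    simp only [tangentAt, Submodule.mem_iInf, LinearMap.mem_ker] at hw
    induction hf using Submodule.span_induction with
    | mem f hf => obtain ⟨j, rfl⟩ := hf; exact hw j
    | zero => rfl
    | add f g _ _ hf hg => rw [LinearMap.add_apply, hf, hg, add_zero]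
    | smul c f _ hf => rw [LinearMap.smul_apply, hf, smul_zero]
  have hsum := Subspace.finrank_add_finrank_dualCoannihilator_eq (Submodule.span ℝ (range dA))
  rw [finrank_span_eq_card hdA, Fintype.card_fin, Module.finrank_prod,
    Module.finrank_fin_fun] at hsum
  have hfin : Module.finrank ℝ (tangentAt A z) ≤ d := by
    have := Submodule.finrank_mono htan
    omega
  have heq := Submodule.eq_of_le_of_finrank_le hle (hfin.trans hrank.ge)
  rw [← heq] at hv
  exact hv

/-- Linear coordinates on the phase space that are adapted to the Hamiltonian vectors at `z`. -/
theorem exists_leftInverse_hamComb {z : Phase d}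
    (hz : LinearIndependent ℝ fun j => fderiv ℝ (A j) z) :
    ∃ ℓ : Phase d →L[ℝ] (Fin d → ℝ), ∀ h, ℓ (hamComb A z h) = h := by
  obtain ⟨ℓ, hℓ⟩ := (hamComb A z : (Fin d → ℝ) →ₗ[ℝ] Phase d).exists_leftInverse_of_injective
    (LinearMap.ker_eq_bot.2 (hamComb_injective hz))
  exact ⟨ℓ.toContinuousLinearMap, fun h => congrArg (fun L => L h) hℓ⟩

theorem IsAngularChart.multiTime_eq {τ : Fin d → Fin d → ℝ}
    {e : (Fin d → Real.Angle) ≃ₜ levelSet A a} (he : IsAngularChart φ A a τ e) (z : levelSet A a)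
    (j : Fin d) : multiTime φ (τ j) z = (z : Phase d) := by
  obtain ⟨θ, rfl⟩ := e.surjective z
  have h1 := he θ (Pi.single j (2 * Real.pi))
  have h2 : ∑ i, ((Pi.single j (2 * Real.pi) : Fin d → ℝ) i / (2 * Real.pi)) • τ i = τ j := by
    rw [Finset.sum_eq_single j]
    · rw [Pi.single_eq_same, div_self Real.two_pi_pos.ne', one_smul]
    · intro i _ hi
      rw [Pi.single_eq_of_ne hi, zero_div, zero_smul]
    · simp
  rw [h2] at h1
  rw [h1]
  congr 2
  funext i
  rcases eq_or_ne i j with rfl | hi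
  · simp
  · simp [Pi.single_eq_of_ne hi]

namespace IsIntegrableSystem

theorem isCommutingFlows (h : IsIntegrableSystem A φ) :
    IsCommutingFlows (fun j => hamVec (A j)) φ :=
  isCommutingFlows_hamVec h.contDiff h.involution h.flow

theorem isCommutingActions (h : IsIntegrableSystem A φ) : IsCommutingActions φ :=
  h.isCommutingFlows.isCommutingActions

theorem multiTime_mem (h : IsIntegrableSystem A φ) (t : Fin d → ℝ) {z : Phase d}
    (hz : z ∈ levelSet A a) : multiTime φ t z ∈ levelSet A a :=
  multiTime_mem_levelSet h.contDiff h.involution h.flow hz t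

/-- Near a regular point `z`, the points of the level set lie on the orbit of `z`, with arbitrarily
small multi-times. Indeed `(A, ℓ)`, with `ℓ` as in `exists_leftInverse_hamComb`, is a local
diffeomorphism at `z`, and `t ↦ ℓ (Φ^t z)` is one at `0`. -/
theorem eventually_exists_multiTime_eq (h : IsIntegrableSystem A φ)
    (hT : IsLiouvilleArnoldTorus A a) {z : Phase d} (hz : z ∈ levelSet A a)
    {N : Set (Fin d → ℝ)} (hN : N ∈ 𝓝 0) :
    ∀ᶠ w in 𝓝 z, w ∈ levelSet A a → ∃ t ∈ N, multiTime φ t z = w := by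
  have hind := hT.independent z hz
  obtain ⟨ℓ, hℓ⟩ := exists_leftInverse_hamComb hind
  -- the local coordinates `(A, ℓ)`
  let f : Phase d → Phase d := fun w => (fun j => A j w, ℓ w)
  let f' : Phase d →L[ℝ] Phase d := (ContinuousLinearMap.pi fun j => fderiv ℝ (A j) z).prod ℓ
  have hf' : HasStrictFDerivAt f f' z :=
    (hasStrictFDerivAt_pi.2 fun j =>
      ((h.contDiff j).contDiffAt.hasStrictFDerivAt (by simp))).prodMk ℓ.hasStrictFDerivAt
  have hinj : Function.Injective (f' : Phase d →ₗ[ℝ] Phase d) := by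
    rw [injective_iff_map_eq_zero]
    intro v hv
    have hv1 : ∀ j, fderiv ℝ (A j) z v = 0 := fun j => congrFun (congrArg Prod.fst hv) j
    have hv2 : ℓ v = 0 := congrArg Prod.snd hv
    have hvt : v ∈ tangentAt A z := by
      simp only [tangentAt, Submodule.mem_iInf, LinearMap.mem_ker]
      exact hv1
    obtain ⟨c, rfl⟩ := exists_hamComb_eq h.involution hind hvt
    rw [hℓ] at hv2
    rw [hv2, map_zero]
  let e : Phase d ≃L[ℝ] Phase d :=
    (LinearEquiv.ofInjectiveEndo (f' : Phase d →ₗ[ℝ] Phase d) hinj).toContinuousLinearEquiv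
  have he : (e : Phase d →L[ℝ] Phase d) = f' := by
    refine ContinuousLinearMap.ext fun v => rfl
  have hfe : HasStrictFDerivAt f (e : Phase d →L[ℝ] Phase d) z := by rwa [he]
  have hleft := hfe.eventually_left_inverse
  -- the orbit of `z` in the coordinates `ℓ`
  have horb : HasStrictFDerivAt (fun t => ℓ (multiTime φ t z))
      ((ContinuousLinearEquiv.refl ℝ (Fin d → ℝ) : (Fin d → ℝ) →L[ℝ] (Fin d → ℝ))) 0 := by
    have h1 := h.isCommutingFlows.hasStrictFDerivAt_multiTime z 0
    rw [h.isCommutingActions.multiTime_zero] at h1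
    refine (ℓ.hasStrictFDerivAt.comp 0 h1).congr_fderiv ?_
    exact ContinuousLinearMap.ext fun c => hℓ c
  have hcont : ContinuousAt (fun t => multiTime φ t z) 0 :=
    (h.isCommutingFlows.hasStrictFDerivAt_multiTime z 0).hasFDerivAt.continuousAt
  have hN' : {t | t ∈ N ∧ hfe.localInverse f e z (f (multiTime φ t z)) = multiTime φ t z}
      ∈ 𝓝 (0 : Fin d → ℝ) := by
    have hev : ∀ᶠ w in 𝓝 (multiTime φ 0 z), hfe.localInverse f e z (f w) = w := by
      rwa [h.isCommutingActions.multiTime_zero]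
    filter_upwards [hN, hcont.eventually hev] with t h1 h2 using ⟨h1, h2⟩
  have himg := image_mem_map (m := fun t => ℓ (multiTime φ t z)) hN'
  rw [horb.map_nhds_eq_of_equiv, h.isCommutingActions.multiTime_zero] at himg
  filter_upwards [hleft, ℓ.continuous.continuousAt himg] with w hw hwi hwT
  obtain ⟨t, ⟨htN, ht⟩, htw⟩ := hwi
  refine ⟨t, htN, ?_⟩
  have hff : f (multiTime φ t z) = f w :=
    Prod.ext (funext fun j => (h.multiTime_mem t hz j).trans (hwT j).symm) htw
  rw [← ht, hff, hw]

/-- The orbit map `t ↦ Φ^t z` of a point of the torus. -/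
def orbitMap (h : IsIntegrableSystem A φ) (z : levelSet A a) (t : Fin d → ℝ) : levelSet A a :=
  ⟨multiTime φ t z, h.multiTime_mem t z.2⟩

theorem continuous_orbitMap (h : IsIntegrableSystem A φ) (z : levelSet A a) :
    Continuous (h.orbitMap z) :=
  (h.isCommutingFlows.continuous_multiTime.comp (f := fun t : Fin d → ℝ => (t, (z : Phase d)))
    (by fun_prop)).subtype_mk _

theorem isOpenMap_orbitMap (h : IsIntegrableSystem A φ) (hT : IsLiouvilleArnoldTorus A a)
    (z : levelSet A a) : IsOpenMap (h.orbitMap z) := by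
  rw [isOpenMap_iff_nhds_le]
  intro t U hU
  have hN : (fun s => h.orbitMap z (s + t)) ⁻¹' U ∈ 𝓝 (0 : Fin d → ℝ) := by
    have : Tendsto (fun s : Fin d → ℝ => s + t) (𝓝 0) (𝓝 t) := by
      have : Continuous fun s : Fin d → ℝ => s + t := by fun_prop
      simpa using this.tendsto 0
    exact this hU
  have hev := h.eventually_exists_multiTime_eq hT (h.orbitMap z t).2 hN
  filter_upwards [continuous_subtype_val.continuousAt.eventually hev] with w hw
  obtain ⟨s, hs, hsw⟩ := hw w.2
  have heq : h.orbitMap z (s + t) = w :=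
    Subtype.ext ((h.isCommutingActions.multiTime_add s t z).trans hsw)
  rw [← heq]
  exact hs

/-- The multi-time flow is transitive on the torus: its orbits are open, hence also closed. -/
theorem surjective_orbitMap (h : IsIntegrableSystem A φ) (hT : IsLiouvilleArnoldTorus A a)
    (z : levelSet A a) : Function.Surjective (h.orbitMap z) := by
  have : ConnectedSpace (levelSet A a) := Subtype.connectedSpace hT.connected
  have hcl : IsClopen (range (h.orbitMap z)) := by
    refine ⟨?_, (h.isOpenMap_orbitMap hT z).isOpen_range⟩
    rw [← isOpen_compl_iff]
    have : (range (h.orbitMap z))ᶜ = ⋃ w ∈ (range (h.orbitMap z))ᶜ, range (h.orbitMap w) := by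
      ext w
      simp only [mem_iUnion, exists_prop]
      constructor
      · exact fun hw => ⟨w, hw, 0, Subtype.ext (h.isCommutingActions.multiTime_zero _)⟩
      · rintro ⟨w', hw', s, rfl⟩ ⟨t, ht⟩
        refine hw' ⟨-s + t, Subtype.ext ?_⟩
        change multiTime φ (-s + t) z = w'
        have ht' : multiTime φ t z = multiTime φ s w' := congrArg Subtype.val ht
        rw [h.isCommutingActions.multiTime_add, ht', h.isCommutingActions.multiTime_neg]
    rw [this]
    exact isOpen_biUnion fun w _ => (h.isOpenMap_orbitMap hT w).isOpen_range
  exact range_eq_univ.1 (hcl.eq_univ ⟨_, mem_range_self 0⟩)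

/-! ### The period lattice and angular coordinates -/

/-- The multi-times that fix the point `z`. -/
def periods (h : IsIntegrableSystem A φ) (z : levelSet A a) : Submodule ℤ (Fin d → ℝ) :=
  AddSubgroup.toIntSubmodule
    { carrier := {t | multiTime φ t z = (z : Phase d)}
      zero_mem' := h.isCommutingActions.multiTime_zero _
      add_mem' := fun {s t} hs ht => by
        rw [mem_ofPred_eq] at hs ht ⊢
        rw [h.isCommutingActions.multiTime_add, ht, hs]
      neg_mem' := fun {t} ht => by
        rw [mem_ofPred_eq] at ht ⊢
        conv_lhs => rw [← ht]
        exact h.isCommutingActions.multiTime_neg t z }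

theorem mem_periods (h : IsIntegrableSystem A φ) {z : levelSet A a} {t : Fin d → ℝ} :
    t ∈ h.periods z ↔ multiTime φ t z = (z : Phase d) := Iff.rfl

theorem orbitMap_eq_iff (h : IsIntegrableSystem A φ) {z : levelSet A a} {s t : Fin d → ℝ} :
    h.orbitMap z s = h.orbitMap z t ↔ s - t ∈ h.periods z := by
  rw [mem_periods, Subtype.ext_iff]
  change multiTime φ s z = multiTime φ t z ↔ _
  constructor
  · intro hst
    rw [sub_eq_neg_add, h.isCommutingActions.multiTime_add, hst, h.isCommutingActions.multiTime_neg]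
  · intro hst
    conv_rhs => rw [← hst]
    rw [← h.isCommutingActions.multiTime_add, add_sub_cancel]

/-- Periods are isolated, since the derivative of the orbit map at `0` is injective. -/
theorem discreteTopology_periods (h : IsIntegrableSystem A φ) (hT : IsLiouvilleArnoldTorus A a)
    (z : levelSet A a) : DiscreteTopology (h.periods z) := by
  obtain ⟨ℓ, hℓ⟩ := exists_leftInverse_hamComb (hT.independent z z.2)
  have hd := (h.isCommutingFlows.hasStrictFDerivAt_multiTime (z : Phase d) 0).hasFDerivAt
  rw [h.isCommutingActions.multiTime_zero] at hd
  have hne := hd.eventually_ne (c := (z : Phase d)) ⟨_, ℓ.lipschitz.to_rightInverse hℓ⟩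
  rw [eventually_nhdsWithin_iff] at hne
  refine discreteTopology_of_isOpen_singleton_zero (G := h.periods z) ?_
  rw [isOpen_iff_mem_nhds]
  rintro _ rfl
  filter_upwards [(continuous_subtype_val (p := (· ∈ h.periods z))).continuousAt.eventually hne]
    with t ht
  by_contra h0
  exact ht (fun h1 => h0 (Subtype.ext h1)) t.2

/-- The periods span `ℝ^d`: by compactness of the torus, every multi-time is a period up to a
bounded error, so that a linear form which vanishes on the periods is bounded. -/
theorem span_periods (h : IsIntegrableSystem A φ) (hT : IsLiouvilleArnoldTorus A a)
    (z : levelSet A a) : Submodule.span ℝ (h.periods z : Set (Fin d → ℝ)) = ⊤ := by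
  have : CompactSpace (levelSet A a) := isCompact_iff_compactSpace.1 hT.compact
  obtain ⟨n, hn⟩ : ∃ n : ℕ, h.orbitMap z '' ball 0 n = univ := by
    have hcov := isCompact_univ.elim_directed_cover (fun n : ℕ => h.orbitMap z '' ball 0 n)
      (fun n => h.isOpenMap_orbitMap hT z _ isOpen_ball) (fun w _ => by
        obtain ⟨t, rfl⟩ := h.surjective_orbitMap hT z w
        obtain ⟨n, hn⟩ := exists_nat_gt ‖t‖
        exact mem_iUnion.2 ⟨n, t, by simpa using hn, rfl⟩)
      (Monotone.directed_le fun m n hmn =>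
        image_mono (ball_subset_ball (by exact_mod_cast hmn)))
    obtain ⟨n, hn⟩ := hcov
    exact ⟨n, univ_subset_iff.1 hn⟩
  by_contra hspan
  obtain ⟨f, hf0, hf⟩ := Submodule.exists_le_ker_of_lt_top _ (lt_top_iff_ne_top.2 hspan)
  let f' := f.toContinuousLinearMap
  have hbound : ∀ t, ‖f t‖ ≤ ‖f'‖ * n := by
    intro t
    obtain ⟨s, hs, hst⟩ : h.orbitMap z t ∈ h.orbitMap z '' ball 0 n := hn ▸ mem_univ _
    have hper : t - s ∈ h.periods z := h.orbitMap_eq_iff.1 hst.symm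
    have : f (t - s) = 0 := hf (Submodule.subset_span hper)
    rw [map_sub, sub_eq_zero] at this
    rw [this]
    refine (f'.le_opNorm s).trans (mul_le_mul_of_nonneg_left ?_ (norm_nonneg _))
    simpa using (mem_ball_zero_iff.1 hs).le
  refine hf0 (LinearMap.ext fun t => ?_)
  by_contra hne
  have hpos : 0 < ‖f t‖ := norm_pos_iff.2 hne
  obtain ⟨k, hk⟩ := exists_nat_gt (‖f'‖ * n / ‖f t‖)
  rw [div_lt_iff₀ hpos] at hk
  have := hbound ((k : ℝ) • t)
  rw [map_smul, norm_smul, Real.norm_natCast] at this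
  linarith

/-- A basis of `ℝ^d` that generates the lattice of periods. -/
theorem exists_basis_periods (h : IsIntegrableSystem A φ) (hT : IsLiouvilleArnoldTorus A a)
    (z : levelSet A a) : ∃ b : Module.Basis (Fin d) ℝ (Fin d → ℝ),
      ∀ t, t ∈ h.periods z ↔ ∀ j, ∃ k : ℤ, b.repr t j = k := by
  have := h.discreteTopology_periods hT z
  have : IsZLattice ℝ (h.periods z) := ⟨h.span_periods hT z⟩
  have hrank : Module.finrank ℤ (h.periods z) = d := by
    rw [ZLattice.rank ℝ, Module.finrank_fin_fun]
  have := ZLattice.module_finite ℝ (h.periods z)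
  have := ZLattice.module_free ℝ (h.periods z)
  let b := Module.finBasisOfFinrankEq ℤ (h.periods z) hrank
  refine ⟨b.ofZLatticeBasis ℝ, fun t => ⟨fun ht j => ?_, fun ht => ?_⟩⟩
  · exact ⟨b.repr ⟨t, ht⟩ j, b.ofZLatticeBasis_repr_apply ℝ (h.periods z) ⟨t, ht⟩ j⟩
  · choose k hk using ht
    rw [← (b.ofZLatticeBasis ℝ).sum_repr t]
    refine Submodule.sum_mem _ fun j _ => ?_
    rw [hk, b.ofZLatticeBasis_apply ℝ, Int.cast_smul_eq_zsmul]
    exact Submodule.smul_mem _ _ (b j).2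

theorem exists_isAngularChart (h : IsIntegrableSystem A φ) (hT : IsLiouvilleArnoldTorus A a) :
    ∃ (τ : Fin d → Fin d → ℝ) (e : (Fin d → Real.Angle) ≃ₜ levelSet A a),
      IsAngularChart φ A a τ e := by
  have : CompactSpace (levelSet A a) := isCompact_iff_compactSpace.1 hT.compact
  obtain ⟨z₀, hz₀⟩ := hT.connected.nonempty
  let z : levelSet A a := ⟨z₀, hz₀⟩
  obtain ⟨b, hb⟩ := h.exists_basis_periods hT z
  -- the multi-time with coordinates `s / 2π` in the basis of periods
  let T : (Fin d → ℝ) → Fin d → ℝ := fun s => ∑ j, (s j / (2 * Real.pi)) • b j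
  have hTadd : ∀ s s', T (s + s') = T s + T s' := fun s s' => by
    simp only [T, Pi.add_apply, add_div, add_smul, Finset.sum_add_distrib]
  have hTsub : ∀ s s', T (s - s') = T s - T s' := fun s s' => by
    simp only [T, Pi.sub_apply, sub_div, sub_smul, Finset.sum_sub_distrib]
  have hrepr : ∀ s j, b.repr (T s) j = s j / (2 * Real.pi) := fun s j => by
    rw [Module.Basis.repr_sum_self]
  let q : (Fin d → ℝ) → levelSet A a := fun s => h.orbitMap z (T s)
  have hq : ∀ s s', q s = q s' ↔ (fun j => (s j : Real.Angle)) = fun j => (s' j : Real.Angle) := by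
    intro s s'
    rw [h.orbitMap_eq_iff, ← hTsub, hb, funext_iff]
    refine forall_congr' fun j => ?_
    rw [hrepr, Real.Angle.angle_eq_iff_two_pi_dvd_sub, Pi.sub_apply]
    refine exists_congr fun k => ?_
    rw [div_eq_iff Real.two_pi_pos.ne', mul_comm]
  let f : (Fin d → Real.Angle) → levelSet A a := fun θ => q fun j => (θ j).toReal
  have hfq : ∀ s, f (fun j => (s j : Real.Angle)) = q s := fun s => by
    rw [hq]
    simp
  have hfc : Continuous f := by
    have hquot : IsOpenQuotientMap (Pi.map fun _ : Fin d => ((↑) : ℝ → Real.Angle)) :=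
      IsOpenQuotientMap.piMap fun _ => QuotientAddGroup.isOpenQuotientMap_mk
    rw [← hquot.continuous_comp_iff]
    have : f ∘ (Pi.map fun _ : Fin d => ((↑) : ℝ → Real.Angle)) = q := funext hfq
    rw [this]
    exact (h.continuous_orbitMap z).comp (by fun_prop)
  have hbij : Function.Bijective f := by
    constructor
    · intro θ θ' hθ
      have := (hq _ _).1 hθ
      simpa using this
    · intro w
      obtain ⟨t, rfl⟩ := h.surjective_orbitMap hT z w
      refine ⟨fun j => ((2 * Real.pi * b.repr t j : ℝ) : Real.Angle), ?_⟩
      rw [hfq]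
      refine congrArg (h.orbitMap z) ?_
      refine b.ext_elem fun j => ?_
      rw [hrepr, mul_div_cancel_left₀ _ Real.two_pi_pos.ne']
  have : Fact (0 < 2 * Real.pi) := ⟨Real.two_pi_pos⟩
  have : CompactSpace Real.Angle := inferInstanceAs (CompactSpace (AddCircle (2 * Real.pi)))
  let e : (Fin d → Real.Angle) ≃ₜ levelSet A a :=
    Continuous.homeoOfEquivCompactToT2 (f := Equiv.ofBijective f hbij) hfc
  have he : ∀ θ, e θ = f θ := fun _ => rfl
  refine ⟨b, e, fun θ s => ?_⟩
  have hθ : (fun j => θ j + (s j : Real.Angle)) =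
      fun j => ((((fun j => (θ j).toReal) + s) j : ℝ) : Real.Angle) := by
    funext j
    simp
  rw [he, he, hθ, hfq]
  change multiTime φ (T s) (multiTime φ (T _) z) = multiTime φ (T _) z
  rw [hTadd, add_comm, h.isCommutingActions.multiTime_add]

/-- The periods `τ_j` of an angular chart generate all periods. They form a basis of `ℝ^d`, since a
relation `∑ j, c_j τ_j = 0` would make the chart invariant under the translations of the angles by
all multiples of `c`; and an angle is fixed by the translations in `2πℤ` only. -/
theorem exists_eq_sum_zsmul_period (h : IsIntegrableSystem A φ) {τ : Fin d → Fin d → ℝ}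
    {e : (Fin d → Real.Angle) ≃ₜ levelSet A a} (he : IsAngularChart φ A a τ e) (z : levelSet A a)
    {t : Fin d → ℝ} (ht : multiTime φ t z = (z : Phase d)) :
    ∃ k : Fin d → ℤ, t = ∑ j, k j • τ j := by
  -- a period with real coordinates `c` in `τ` has integral coordinates
  have key : ∀ (w : levelSet A a) (c : Fin d → ℝ),
      multiTime φ (∑ j, c j • τ j) w = (w : Phase d) → ∀ j, ∃ k : ℤ, c j = k := by
    intro w c hc j
    obtain ⟨θ, rfl⟩ := e.surjective w
    have h1 := he θ (fun j => 2 * Real.pi * c j)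
    simp only [mul_div_cancel_left₀ _ Real.two_pi_pos.ne'] at h1
    rw [hc] at h1
    have h2 := congrFun (e.injective (Subtype.ext h1)) j
    rw [left_eq_add, ← Real.Angle.coe_zero, Real.Angle.angle_eq_iff_two_pi_dvd_sub] at h2
    obtain ⟨k, hk⟩ := h2
    rw [sub_zero] at hk
    exact ⟨k, mul_left_cancel₀ Real.two_pi_pos.ne' hk⟩
  have hli : LinearIndependent ℝ τ := by
    rw [Fintype.linearIndependent_iff]
    intro c hc j
    by_contra hj
    -- rescaled, the relation has the `j`-th coefficient `1 / 2`, which is not integral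
    have hc' : ∑ i, ((2 * c j)⁻¹ * c i) • τ i = 0 := by
      simp only [mul_smul]
      rw [← Finset.smul_sum, hc, smul_zero]
    obtain ⟨k, hk⟩ := key z (fun i => (2 * c j)⁻¹ * c i)
      (by rw [hc', h.isCommutingActions.multiTime_zero]) j
    have h2 : (2 * k : ℝ) = 1 := by
      rw [← hk]
      field_simp
    have h3 : 2 * k = 1 := by exact_mod_cast h2
    omega
  have hspan : Submodule.span ℝ (range τ) = ⊤ := by
    refine hli.span_eq_top_of_card_eq_finrank' ?_
    rw [Fintype.card_fin, Module.finrank_fin_fun]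
  obtain ⟨c, hc⟩ := (Submodule.mem_span_range_iff_exists_fun ℝ).1
    (hspan ▸ Submodule.mem_top : t ∈ Submodule.span ℝ (range τ))
  choose k hk using key z c (by rw [hc, ht])
  refine ⟨k, ?_⟩
  rw [← hc]
  exact Finset.sum_congr rfl fun j _ => by rw [hk, Int.cast_smul_eq_zsmul]

end IsIntegrableSystem

end Torus

/-! ### The connection defined by the transport equations -/

section Connection

variable {d n : ℕ} {G : Subgroup (Matrix.unitaryGroup (Fin n) ℂ)}
  {A : Fin d → Phase d → ℝ} {φ : Fin d → ℝ → Phase d → Phase d}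
  {M : Fin d → Phase d → lieAlg G} {D : Fin d → Phase d → ℝ → G} {a : Fin d → ℝ}

/-- Near a regular point, the coefficients of a vector with respect to the Hamiltonian vectors
extend to one-forms on the phase space that depend smoothly on the base point. -/
theorem exists_smooth_coefficients (hA : ∀ j, ContDiff ℝ ∞ (A j)) {z : Phase d}
    (hz : LinearIndependent ℝ fun j => fderiv ℝ (A j) z) :
    ∃ (U : Set (Phase d)) (κ : Phase d → Phase d →L[ℝ] (Fin d → ℝ)), IsOpen U ∧ z ∈ U ∧
      ContDiffOn ℝ ∞ κ U ∧ ∀ w ∈ U, ∀ c, κ w (hamComb A w c) = c := by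
  obtain ⟨ℓ, hℓ⟩ := exists_leftInverse_hamComb hz
  let L : Phase d → (Fin d → ℝ) →L[ℝ] (Fin d → ℝ) := fun w => ℓ.comp (hamComb A w)
  have hL : ContDiff ℝ ∞ L :=
    contDiff_const.clm_comp (contDiff_combination fun j => contDiff_hamVec (hA j))
  refine ⟨L ⁻¹' {x | IsUnit x}, fun w => (Ring.inverse (L w)).comp ℓ,
    Units.isOpen.preimage hL.continuous, ?_, ?_, ?_⟩
  · have : L z = 1 := ContinuousLinearMap.ext hℓ
    change IsUnit (L z)
    rw [this]
    exact isUnit_one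
  · rintro w ⟨x, hx⟩
    have h1 : ContDiffAt ℝ ∞ Ring.inverse (L w) := hx ▸ contDiffAt_ringInverse ℝ x
    exact ((h1.comp w hL.contDiffAt).clm_comp contDiffAt_const).contDiffWithinAt
  · intro w hw c
    have := Ring.inverse_mul_cancel (L w) hw
    exact congrArg (fun B => B c) this

/-- The Hamiltonian vectors as a basis of the tangent space of the level set at a regular point. -/
noncomputable def tangentEquiv (hinv : InInvolution A) {z : Phase d}
    (hz : LinearIndependent ℝ fun j => fderiv ℝ (A j) z) : (Fin d → ℝ) ≃ₗ[ℝ] tangentAt A z :=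
  LinearEquiv.ofBijective
    ((hamComb A z : (Fin d → ℝ) →ₗ[ℝ] Phase d).codRestrict _ (hamComb_mem_tangentAt hinv z))
    ⟨fun _ _ h => hamComb_injective hz (congrArg Subtype.val h), fun v => by
      obtain ⟨c, hc⟩ := exists_hamComb_eq hinv hz v.2
      exact ⟨c, Subtype.ext hc⟩⟩

theorem hamComb_tangentEquiv_symm (hinv : InInvolution A) {z : Phase d}
    (hz : LinearIndependent ℝ fun j => fderiv ℝ (A j) z) (v : tangentAt A z) :
    hamComb A z ((tangentEquiv hinv hz).symm v) = v :=
  congrArg Subtype.val ((tangentEquiv hinv hz).apply_symm_apply v)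

/-- The connection form that takes the value `M_j` on the Hamiltonian vector field of `A_j`. -/
noncomputable def transportConnection (hA : ∀ j, ContDiff ℝ ∞ (A j)) (hinv : InInvolution A)
    (hM : ∀ j, ContDiff ℝ ∞ fun z => (M j z : Mat n)) (hT : IsLiouvilleArnoldTorus A a) :
    Connection A a G where
  form z := (Fintype.linearCombination ℝ fun j => M j z).comp
    (tangentEquiv hinv (hT.independent z z.2)).symm.toLinearMap
  smooth z := by
    obtain ⟨U, κ, hU, hzU, hκ, hκc⟩ := exists_smooth_coefficients hA (hT.independent z z.2)
    refine ⟨U, fun w => (Fintype.linearCombination ℝ fun j => (M j w : Mat n)).comp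
      (κ w : Phase d →ₗ[ℝ] (Fin d → ℝ)), hU, hzU, fun v => ?_, fun w hw v => ?_⟩
    · simp only [LinearMap.comp_apply, Fintype.linearCombination_apply]
      refine ContDiffOn.sum fun j _ => ?_
      have h1 : ContDiffOn ℝ ∞ (fun w => κ w v j) U :=
        contDiffOn_pi.1 (hκ.clm_apply contDiffOn_const) j
      exact h1.smul (hM j).contDiffOn
    · simp only [LinearMap.comp_apply, Fintype.linearCombination_apply, LinearEquiv.coe_coe]
      have : κ w v = (tangentEquiv hinv (hT.independent w w.2)).symm v := by
        conv_lhs => rw [← hamComb_tangentEquiv_symm hinv (hT.independent w w.2) v]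
        exact hκc w hw _
      rw [← this, Submodule.coe_sum]
      rfl

theorem transportConnection_hamVec (hA : ∀ j, ContDiff ℝ ∞ (A j)) (hinv : InInvolution A)
    (hM : ∀ j, ContDiff ℝ ∞ fun z => (M j z : Mat n)) (hT : IsLiouvilleArnoldTorus A a)
    (j : Fin d) (z : levelSet A a) : (transportConnection hA hinv hM hT).form z
      ⟨hamVec (A j) z, hamVec_mem_tangentAt hinv j z⟩ = M j z := by
  have h : (⟨hamVec (A j) z, hamVec_mem_tangentAt hinv j z⟩ : tangentAt A (z : Phase d)) =
      tangentEquiv hinv (hT.independent z z.2) (Pi.single j 1) := by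
    refine Subtype.ext ?_
    change _ = hamComb A z (Pi.single j 1)
    rw [combination_apply, Finset.sum_eq_single j]
    · rw [Pi.single_eq_same, one_smul]
    · intro i _ hi
      rw [Pi.single_eq_of_ne hi, zero_smul]
    · simp
  rw [h]
  simp [transportConnection]

theorem combination_extVec (c : Fin d → ℝ) (y : Phase d × Mat n) :
    ∑ j, c j • extVec (A j) (M j) y =
      (hamComb A y.1 c, -(((∑ j, c j • M j y.1 : lieAlg G) : Mat n) * y.2)) := by
  refine Prod.ext ?_ ?_
  · rw [Prod.fst_sum, combination_apply]
    rfl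
  · rw [Prod.snd_sum, Submodule.coe_sum, Finset.sum_mul, ← Finset.sum_neg_distrib]
    refine Finset.sum_congr rfl fun j _ => ?_
    change c j • -((M j y.1 : Mat n) * y.2) = -(((c j • M j y.1 : lieAlg G) : Mat n) * y.2)
    rw [Submodule.coe_smul, smul_neg, smul_mul_assoc]

/-- `η` takes the value `M_j` on the Hamiltonian vector field of `A_j`. -/
def IsTransportConnection (hinv : InInvolution A) (M : Fin d → Phase d → lieAlg G)
    (η : Connection A a G) : Prop :=
  ∀ j (z : levelSet A a), η.form z ⟨hamVec (A j) z, hamVec_mem_tangentAt hinv j z⟩ = M j z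

namespace IsTransportConnection

variable {hinv : InInvolution A} {η η' : Connection A a G}

theorem form_hamComb (hη : IsTransportConnection hinv M η) (z : levelSet A a) (c : Fin d → ℝ) :
    η.form z ⟨hamComb A z c, hamComb_mem_tangentAt hinv z c⟩ = ∑ j, c j • M j z := by
  have h : (⟨hamComb A z c, hamComb_mem_tangentAt hinv z c⟩ : tangentAt A (z : Phase d)) =
      ∑ j, c j • ⟨hamVec (A j) z, hamVec_mem_tangentAt hinv j z⟩ := by
    refine Subtype.ext ?_
    rw [Submodule.coe_sum]
    exact combination_apply _ _ _
  rw [h, map_sum]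
  exact Finset.sum_congr rfl fun j _ => by rw [map_smul, hη j z]

theorem unique (hT : IsLiouvilleArnoldTorus A a) (hη : IsTransportConnection hinv M η)
    (hη' : IsTransportConnection hinv M η') : η' = η := by
  refine Connection.ext (funext fun z => LinearMap.ext fun v => ?_)
  obtain ⟨v, hv⟩ := v
  obtain ⟨c, rfl⟩ := exists_hamComb_eq hinv (hT.independent z z.2) hv
  rw [hη.form_hamComb, hη'.form_hamComb]

/-! ### Horizontal curves and holonomy -/

/-- A horizontal curve is moved by the extended flows: its velocity is a combination of the
Hamiltonian vectors with continuous coefficients `u_j`, and it solves the same equation as the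
multi-time extension along `∫ u`. -/
theorem exists_multiTime_of_horizontalStep (hA : ∀ j, ContDiff ℝ ∞ (A j))
    (hT : IsLiouvilleArnoldTorus A a)
    (hY : IsCommutingFlows (fun j => extVec (A j) (M j)) fun j => matExtension (φ j) (D j))
    (hη : IsTransportConnection hinv M η) {y y' : levelSet A a × G} (h : HorizontalStep η y y') :
    ∃ t, multiTime (fun j => extension (φ j) (D j)) t ((y.1 : Phase d), y.2) =
      ((y'.1 : Phase d), y'.2) := by
  obtain ⟨c, v, g, hc, hv, hg, rfl, rfl⟩ := h
  let u : ℝ → Fin d → ℝ := fun t => (tangentEquiv hinv (hT.independent (c t) (c t).2)).symm (v t)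
  have hu : ∀ t, hamComb A (c t) (u t) = v t := fun t => hamComb_tangentEquiv_symm hinv _ (v t)
  have hcc : ContinuousOn (fun t => (c t : Phase d)) (Icc 0 1) :=
    fun t ht => (hc t ht).continuousWithinAt
  have huc : ContinuousOn u (Icc 0 1) := by
    intro t ht
    obtain ⟨U, κ, hU, hzU, hκ, hκc⟩ :=
      exists_smooth_coefficients hA (hT.independent (c t) (c t).2)
    have h1 : ContinuousWithinAt (fun s => κ (c s) (v s)) (Icc 0 1) t :=
      (((hκ.continuousOn.continuousAt (hU.mem_nhds hzU)).comp_continuousWithinAt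
        (f := fun s => (c s : Phase d)) (hcc t ht))).clm_apply (hv t ht)
    have heq : ∀ s, (c s : Phase d) ∈ U → u s = κ (c s) (v s) := fun s hs => by
      rw [← hu s, hκc _ hs]
    refine h1.congr_of_eventuallyEq ?_ (heq t hzU)
    filter_upwards [(hcc t ht).eventually (hU.mem_nhds hzU)] with s hs using heq s hs
  have hf : ∀ t ∈ Icc (0 : ℝ) 1, HasDerivWithinAt (fun s => ((c s : Phase d), toMat (g s)))
      (∑ j, u t j • extVec (A j) (M j) ((c t : Phase d), toMat (g t))) (Icc 0 1) t := by
    intro t ht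
    have hform : η.form (c t) (v t) = ∑ j, u t j • M j (c t) := by
      rw [← hη.form_hamComb]
      exact congrArg _ (Subtype.ext (hu t).symm)
    rw [combination_extVec, hu]
    have := (hc t ht).prodMk (hg t ht)
    rw [hform] at this
    exact this
  refine ⟨∫ t in (0 : ℝ)..1, u t, map_toMat_injective ?_⟩
  rw [map_toMat_multiTime]
  exact (hY.eq_multiTime_integral huc hf).symm

/-- Conversely, the multi-time extension along a segment is a horizontal curve. -/
theorem horizontalStep_multiTime (hφ : IsIntegrableSystem A φ)
    (hY : IsCommutingFlows (fun j => extVec (A j) (M j)) fun j => matExtension (φ j) (D j))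
    (hη : IsTransportConnection hinv M η) (z : levelSet A a) (g : G) (t : Fin d → ℝ) :
    HorizontalStep η (z, g) (hφ.orbitMap z t, multiCocycle φ D z t * g) := by
  have hcoord : ∀ s, multiTime (fun j => matExtension (φ j) (D j)) s ((z : Phase d), toMat g) =
      ((hφ.orbitMap z s : Phase d), toMat (multiCocycle φ D z s * g)) := fun s => by
    have := map_toMat_multiTime (φ := φ) (D := D) s ((z : Phase d), g)
    rw [multiTime_extension] at this
    exact this.symm
  have hd : ∀ r : ℝ, HasDerivAt (fun r : ℝ => ((hφ.orbitMap z (r • t) : Phase d),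
      toMat (multiCocycle φ D z (r • t) * g)))
      (∑ j, t j • extVec (A j) (M j) ((hφ.orbitMap z (r • t) : Phase d),
        toMat (multiCocycle φ D z (r • t) * g))) r := by
    intro r
    have h1 := (hY.hasStrictFDerivAt_multiTime ((z : Phase d), toMat g) (r • t)).hasFDerivAt
    have h2 : HasDerivAt (fun r : ℝ => r • t) t r := by
      simpa using (hasDerivAt_id r).smul_const t
    have h3 := h1.comp_hasDerivAt r h2
    rw [combination_apply] at h3
    simp only [Function.comp_def, hcoord] at h3
    exact h3
  simp only [combination_extVec, ← hη.form_hamComb] at hd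
  have hc : ∀ r : ℝ, HasDerivAt (fun r : ℝ => (hφ.orbitMap z (r • t) : Phase d))
      (hamComb A (hφ.orbitMap z (r • t)) t) r := fun r =>
    (ContinuousLinearMap.fst ℝ (Phase d) (Mat n)).hasFDerivAt.comp_hasDerivAt r (hd r)
  refine ⟨fun r => hφ.orbitMap z (r • t),
    fun r => ⟨hamComb A (hφ.orbitMap z (r • t)) t, hamComb_mem_tangentAt hinv _ t⟩,
    fun r => multiCocycle φ D z (r • t) * g, fun r _ => (hc r).hasDerivWithinAt, ?_,
    fun r _ => HasDerivAt.hasDerivWithinAt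
      ((ContinuousLinearMap.snd ℝ (Phase d) (Mat n)).hasFDerivAt.comp_hasDerivAt r (hd r)), ?_, ?_⟩
  · have h1 : Continuous fun r : ℝ => (hφ.orbitMap z (r • t) : Phase d) :=
      continuous_iff_continuousAt.2 fun r => (hc r).continuousAt
    have h2 : Continuous (hamComb A) :=
      (contDiff_combination fun j => contDiff_hamVec (hφ.contDiff j)).continuous
    exact ((h2.comp h1).clm_apply continuous_const).continuousOn
  · have h0 : multiTime (fun j => extension (φ j) (D j)) 0 ((z : Phase d), g) =
        ((z : Phase d), g) :=
      (isCommutingActions_extension hY.isCommutingActions).multiTime_zero _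
    rw [multiTime_extension] at h0
    simp only [zero_smul]
    exact Prod.ext (Subtype.ext (congrArg Prod.fst h0))
      (congrArg Prod.snd h0 : multiCocycle φ D (z : Phase d) 0 * g = g)
  · simp only [one_smul]

/-- Two points are joined by a piecewise continuously differentiable horizontal curve if and only if
they are related by the multi-time extension. -/
theorem horizontallyJoined_iff (hφ : IsIntegrableSystem A φ) (hT : IsLiouvilleArnoldTorus A a)
    (hY : IsCommutingFlows (fun j => extVec (A j) (M j)) fun j => matExtension (φ j) (D j))
    (hη : IsTransportConnection hinv M η) {y y' : levelSet A a × G} :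
    HorizontallyJoined η y y' ↔
      ∃ t, multiTime (fun j => extension (φ j) (D j)) t ((y.1 : Phase d), y.2) =
        ((y'.1 : Phase d), y'.2) := by
  have hact := isCommutingActions_extension hY.isCommutingActions
  constructor
  · intro h
    induction h with
    | refl => exact ⟨0, hact.multiTime_zero _⟩
    | tail _ h2 ih =>
      obtain ⟨s, hs⟩ := ih
      obtain ⟨t, ht⟩ := hη.exists_multiTime_of_horizontalStep hφ.contDiff hT hY h2
      exact ⟨t + s, by rw [hact.multiTime_add, hs, ht]⟩
  · rintro ⟨t, ht⟩
    refine Relation.ReflTransGen.single ?_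
    have h := hη.horizontalStep_multiTime hφ hY y.1 y.2 t
    rw [multiTime_extension] at ht
    have heq : y' = (hφ.orbitMap y.1 t, multiCocycle φ D y.1 t * y.2) :=
      Prod.ext (Subtype.ext (congrArg Prod.fst ht).symm) (congrArg Prod.snd ht).symm
    rwa [heq]

/-- The holonomy group at `z` consists of the multi-time cocycles at the periods of `z`. -/
theorem mem_holonomyGroup (hφ : IsIntegrableSystem A φ) (hT : IsLiouvilleArnoldTorus A a)
    (hY : IsCommutingFlows (fun j => extVec (A j) (M j)) fun j => matExtension (φ j) (D j))
    (hη : IsTransportConnection hinv M η) {z : levelSet A a} {k : G} :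
    k ∈ holonomyGroup η z ↔
      ∃ t, multiTime φ t z = (z : Phase d) ∧ multiCocycle φ D z t = k := by
  refine (hη.horizontallyJoined_iff hφ hT hY (y := (z, 1)) (y' := (z, k))).trans
    (exists_congr fun t => ?_)
  rw [multiTime_extension, mul_one, Prod.ext_iff]

end IsTransportConnection

/-- The cocycles of two periods commute, because the periods commute. -/
theorem commute_multiCocycle (hact : IsCommutingActions fun j => extension (φ j) (D j))
    {z : Phase d} {s t : Fin d → ℝ} (hs : multiTime φ s z = z) (ht : multiTime φ t z = z) :
    Commute (multiCocycle φ D z s) (multiCocycle φ D z t) := by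
  have h1 := multiCocycle_add hact s t z
  rw [add_comm, multiCocycle_add hact, hs, ht] at h1
  exact h1.symm

/-- On the periods of `z`, the cocycle is a homomorphism. -/
noncomputable def periodHom (hφ : IsIntegrableSystem A φ)
    (hact : IsCommutingActions fun j => extension (φ j) (D j)) (z : levelSet A a) :
    Multiplicative (hφ.periods z) →* G :=
  MonoidHom.mk' (fun t => multiCocycle φ D z (t.toAdd : Fin d → ℝ)) fun s t => by
    change multiCocycle φ D z (s.toAdd + t.toAdd : Fin d → ℝ) = _
    rw [multiCocycle_add hact, hφ.mem_periods.1 t.toAdd.2]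

/-- The holonomy group is generated by the loop cocycles, since the periods are generated by the
`τ_j`. -/
theorem holonomyGroup_eq_closure (hφ : IsIntegrableSystem A φ) (hT : IsLiouvilleArnoldTorus A a)
    (hY : IsCommutingFlows (fun j => extVec (A j) (M j)) fun j => matExtension (φ j) (D j))
    {hinv : InInvolution A} {η : Connection A a G} (hη : IsTransportConnection hinv M η)
    {τ : Fin d → Fin d → ℝ} {e : (Fin d → Real.Angle) ≃ₜ levelSet A a}
    (he : IsAngularChart φ A a τ e) (z : levelSet A a) :
    holonomyGroup η z = Subgroup.closure (range fun j => multiCocycle φ D z (τ j)) := by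
  have hact := isCommutingActions_extension hY.isCommutingActions
  refine le_antisymm (fun k hk => ?_) ((Subgroup.closure_le _).2 ?_)
  · obtain ⟨t, ht, rfl⟩ := (hη.mem_holonomyGroup hφ hT hY).1 hk
    obtain ⟨m, hm⟩ := hφ.exists_eq_sum_zsmul_period he z ht
    let p : Fin d → hφ.periods z := fun j => ⟨τ j, he.multiTime_eq z j⟩
    have hsum : (⟨t, ht⟩ : hφ.periods z) = ∑ j, m j • p j := by
      refine Subtype.ext (hm.trans ?_)
      rw [Submodule.coe_sum]
      rfl
    have hmem : (⟨t, ht⟩ : hφ.periods z) ∈ AddSubgroup.closure (range p) := by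
      rw [hsum]
      exact sum_mem fun j _ => zsmul_mem (AddSubgroup.subset_closure (mem_range_self j)) _
    clear hsum hm hk
    change periodHom hφ hact z (Multiplicative.ofAdd ⟨t, ht⟩) ∈ _
    generalize (⟨t, ht⟩ : hφ.periods z) = x at hmem
    induction hmem using AddSubgroup.closure_induction with
    | mem x hx =>
      obtain ⟨j, rfl⟩ := hx
      exact Subgroup.subset_closure (mem_range_self j)
    | zero => rw [ofAdd_zero, map_one]; exact one_mem _
    | add x y _ _ hx hy => rw [ofAdd_add, map_mul]; exact mul_mem hx hy
    | neg x _ hx => rw [ofAdd_neg, map_inv]; exact inv_mem hx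
  · rintro _ ⟨j, rfl⟩
    exact (hη.mem_holonomyGroup hφ hT hY).2 ⟨τ j, he.multiTime_eq z j, rfl⟩

/-- The cocycle from `z` to `z'` conjugates the holonomy groups, by commutativity of the
multi-time flow. -/
theorem holonomyGroup_eq_map_conj (hφ : IsIntegrableSystem A φ) (hT : IsLiouvilleArnoldTorus A a)
    (hY : IsCommutingFlows (fun j => extVec (A j) (M j)) fun j => matExtension (φ j) (D j))
    {hinv : InInvolution A} {η : Connection A a G} (hη : IsTransportConnection hinv M η)
    {z z' : levelSet A a} {t : Fin d → ℝ} (ht : multiTime φ t z = (z' : Phase d)) :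
    holonomyGroup η z' =
      (holonomyGroup η z).map (MulAut.conj (multiCocycle φ D z t)).toMonoidHom := by
  have hact := isCommutingActions_extension hY.isCommutingActions
  have hconj : ∀ s, multiTime φ s z = (z : Phase d) → multiCocycle φ D z' s =
      multiCocycle φ D z t * multiCocycle φ D z s * (multiCocycle φ D z t)⁻¹ := by
    intro s hs
    have h1 := multiCocycle_add hact s t (z : Phase d)
    rw [add_comm, multiCocycle_add hact, hs, ht] at h1
    rw [h1, mul_inv_cancel_right]
  have hper : ∀ s, multiTime φ s z' = (z' : Phase d) ↔ multiTime φ s z = (z : Phase d) := by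
    intro s
    rw [← ht, hφ.isCommutingActions.multiTime_add_comm]
    constructor
    · intro h
      have := congrArg (multiTime φ (-t)) h
      simpa only [hφ.isCommutingActions.multiTime_neg] using this
    · exact fun h => by rw [h]
  ext k
  rw [hη.mem_holonomyGroup hφ hT hY, Subgroup.mem_map]
  constructor
  · rintro ⟨s, hs, rfl⟩
    rw [hper] at hs
    exact ⟨_, (hη.mem_holonomyGroup hφ hT hY).2 ⟨s, hs, rfl⟩, (hconj s hs).symm⟩
  · rintro ⟨_, hk, rfl⟩
    obtain ⟨s, hs, rfl⟩ := (hη.mem_holonomyGroup hφ hT hY).1 hk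
    exact ⟨s, (hper s).2 hs, hconj s hs⟩

end Connection

end SkewProduct

theorem proposition1 {d n : ℕ} (G : Subgroup (Matrix.unitaryGroup (Fin n) ℂ))
    (A : Fin d → Phase d → ℝ) (φ : Fin d → ℝ → Phase d → Phase d)
    (M : Fin d → Phase d → lieAlg G) (D : Fin d → Phase d → ℝ → G)
    -- an integrable system: smooth functions in involution, with their Hamiltonian flows
    (hA : ∀ j, ContDiff ℝ ∞ (A j)) (hinv : InInvolution A)
    (hφ : ∀ j, IsHamiltonianFlow (A j) (φ j))
    -- the group extensions of all the flows, with smooth generators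
    (hM : ∀ j, ContDiff ℝ ∞ (fun z => (M j z : Mat n)))
    (hD : ∀ j, IsTransport (φ j) (M j) (D j))
    (hMinv : ∀ j k z,
      bracket (A j) (fun w => (M k w : Mat n)) z + bracketLeft (fun w => (M j w : Mat n)) (A k) z
        + ((M j z : Mat n) * (M k z : Mat n) - (M k z : Mat n) * (M j z : Mat n)) = 0) :
    -- the group extensions commute
    (∀ j k s t, extension (φ j) (D j) s ∘ extension (φ k) (D k) t =
      extension (φ k) (D k) t ∘ extension (φ j) (D j) s) ∧
    -- on every Liouville–Arnold torus
    (∀ a : Fin d → ℝ, IsLiouvilleArnoldTorus A a →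
      -- the transport equations define a connection `η`
      ∃ η : Connection A a G,
        (∀ j (z : levelSet A a),
          η.form z ⟨hamVec (A j) z, hamVec_mem_tangentAt hinv j z⟩ = M j z) ∧
        (∀ η' : Connection A a G, (∀ j (z : levelSet A a),
          η'.form z ⟨hamVec (A j) z, hamVec_mem_tangentAt hinv j z⟩ = M j z) → η' = η) ∧
        -- its holonomy groups are Abelian
        (∀ z : levelSet A a, ∀ g ∈ holonomyGroup η z, ∀ h ∈ holonomyGroup η z, g * h = h * g) ∧
        -- basis cycles exist, and for every choice of them the holonomy group is generated by
        -- the commuting loop cocycles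
        (∃ (τ : Fin d → Fin d → ℝ) (e : (Fin d → Real.Angle) ≃ₜ levelSet A a),
          IsAngularChart φ A a τ e) ∧
        (∀ (τ : Fin d → Fin d → ℝ) (e : (Fin d → Real.Angle) ≃ₜ levelSet A a),
          IsAngularChart φ A a τ e → ∀ z : levelSet A a,
            (∀ j (g : G), multiTime (fun k => extension (φ k) (D k)) (τ j) ((z : Phase d), g) =
              ((z : Phase d), multiCocycle φ D z (τ j) * g)) ∧
            (∀ j k, Commute (multiCocycle φ D z (τ j)) (multiCocycle φ D z (τ k))) ∧
            holonomyGroup η z =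
              Subgroup.closure (Set.range fun j => multiCocycle φ D z (τ j))) ∧
        -- any two points are related by the multi-time flow, and its cocycle conjugates the
        -- holonomy groups
        (∀ z z' : levelSet A a, ∃ t, multiTime φ t (z : Phase d) = z') ∧
        (∀ (z z' : levelSet A a) (t : Fin d → ℝ), multiTime φ t (z : Phase d) = z' →
          holonomyGroup η z' =
            (holonomyGroup η z).map (MulAut.conj (multiCocycle φ D z t)).toMonoidHom)) := by
  have hsys : IsIntegrableSystem A φ := ⟨hA, hinv, hφ⟩
  have hY := isCommutingFlows_matExtension hA hinv hφ hM hD hMinv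
  have hact := isCommutingActions_extension hY.isCommutingActions
  refine ⟨fun j k s t => funext (hact.comm j k s t), fun a hT => ?_⟩
  have hη : IsTransportConnection hinv M (transportConnection hA hinv hM hT) :=
    transportConnection_hamVec hA hinv hM hT
  refine ⟨transportConnection hA hinv hM hT, hη, fun η' hη' => hη.unique hT hη', ?_,
    hsys.exists_isAngularChart hT, fun τ e he z => ⟨fun j g => ?_, fun j k => ?_, ?_⟩,
    fun z z' => ?_, fun z z' t ht => holonomyGroup_eq_map_conj hsys hT hY hη ht⟩
  · intro z g hg h hh
    obtain ⟨s, hs, rfl⟩ := (hη.mem_holonomyGroup hsys hT hY).1 hg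
    obtain ⟨t, ht, rfl⟩ := (hη.mem_holonomyGroup hsys hT hY).1 hh
    exact commute_multiCocycle hact hs ht
  · rw [multiTime_extension, he.multiTime_eq z j]
  · exact commute_multiCocycle hact (he.multiTime_eq z j) (he.multiTime_eq z k)
  · exact holonomyGroup_eq_closure hsys hT hY hη he z
  · obtain ⟨t, ht⟩ := hsys.surjective_orbitMap hT z z'
    exact ⟨t, congrArg Subtype.val ht⟩
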